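/- A proximate order for an order $\rho\ge 0$ is a differentiable function $\varrho:[0,\infty)\to[0,\infty)$ with $\lim_{r\to\infty}\varrho(r)=\rho$ and $\lim_{r\to\infty}\varrho'(r)\,r\ln r=0$. If $\rho>0$, a normalization of $\varrho$ is a proximate order $\hat\varrho$ for $\rho$ such that $\hat\varrho(r)=\varrho(r)$ for all large $r$ and $r\mapsto r^{\hat\varrho(r)}$ is strictly increasing on $(0,\infty)$ and maps $(0,\infty)$ onto $(0,\infty)$. Let $\varphi$ denote the inverse function of $r\mapsto r^{\hat\varrho(r)}$ on $(0,\infty)$ and put $$G_{\hat\varrho,q}:=\frac{\varphi(q)^q}{(\mathrm e\rho)^{q/\rho}}\quad(q\in\mathbb N),\qquad G_{\hat\varrho,0}=1 .$$ For $\sigma>0$ let $A_{\varrho,\sigma}$ be the space of entire functions $f$ on $\mathbb C^n$ with $$\|f\|_{\varrho,\sigma}:=\sup_{z\in\mathbb C^n}|f(z)|\exp\bigl(-\sigma|z|^{\varrho(|z|)}\bigr)<\infty ,$$ where $|z|$ is the Hermitian norm, normed by $\|\cdot\|_{\varrho,\sigma}$, and let $A_\varrho:=\varinjlim_{\sigma>0}A_{\varrho,\sigma}=\bigcup_{\sigma>0}A_{\varrho,\sigma}$,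 with the locally convex inductive limit topology. **Theorem 4.5.** Let $\varrho_1,\varrho_2$ be proximate orders for orders $\rho_1,\rho_2>0$ with $r^{\varrho_1(r)}=O(r^{\varrho_2(r)})$ as $r\to\infty$, and let $\hat\varrho_1$ be any normalization of $\varrho_1$. Let $\boldsymbol D_{\varrho_1\to\varrho_2}$ be the set of formal differential operators $P=\sum_{\alpha\in\mathbb N^n}a_\alpha(z)\partial_z^\alpha$ with coefficients $a_\alpha\in A_{\varrho_2}$ such that $$\forall\lambda>0\ \exists\sigma>0\ \exists C>0\ \forall\alpha\in\mathbb N^n:\quad a_\alpha\in A_{\varrho_2,\sigma},\quad \|a_\alpha\|_{\varrho_2,\sigma}\le C\,\frac{G_{\hat\varrho_1,|\alpha|}}{\alpha!}\,\lambda^{|\alpha|};$$ two such operators are equal if and only if all their coefficients are equal. For $f\in A_{\varrho_1}$, "$Pf=g$" means that all the terms $a_\alpha\partial_z^\alpha f$ belong to $A_{\varrho_2}$ and that the series $\sum_\alpha a_\alpha\partial_z^\alpha f$ converges unconditionally to $g$ in $A_{\varrho_2}$. (i) If $P\in\boldsymbol D_{\varrho_1\to\varrho_2}$, then for every $f\in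 A_{\varrho_1}$ the series $Pf=\sum_\alpha a_\alpha\partial_z^\alpha f$ converges in this sense, and $f\mapsto Pf$ is a continuous linear map $A_{\varrho_1}\to A_{\varrho_2}$. (ii) For every continuous linear map $F:A_{\varrho_1}\to A_{\varrho_2}$ there is a unique $P\in\boldsymbol D_{\varrho_1\to\varrho_2}$ such that $Ff=Pf$ for all $f\in A_{\varrho_1}$. -/

import Mathlib

open Filter Topology

noncomputable section

namespace ProximateOrder

/-- `ϱ` (only its values on `[0, ∞)` matter) is a proximate order for the order `ρ`. -/
structure IsProximateOrder (ϱ : ℝ → ℝ) (ρ : ℝ) : Prop where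
  nonneg : ∀ r, 0 ≤ r → 0 ≤ ϱ r
  differentiableOn : DifferentiableOn ℝ ϱ (Set.Ici 0)
  tendsto_order : Tendsto ϱ atTop (𝓝 ρ)
  tendsto_deriv : Tendsto (fun r => deriv ϱ r * r * Real.log r) atTop (𝓝 0)

/-- `ϱhat` is a normalization of the proximate order `ϱ` for the order `ρ`: a proximate order that
agrees with `ϱ` for large `r` and for which `r ↦ r ^ ϱhat r` is strictly increasing on `(0, ∞)` and
maps `(0, ∞)` onto `(0, ∞)`. -/
structure IsNormalization (ϱhat ϱ : ℝ → ℝ) (ρ : ℝ) : Prop where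
  isProximateOrder : IsProximateOrder ϱhat ρ
  eq_of_large : ∃ r₁ : ℝ, 0 < r₁ ∧ ∀ r, r₁ ≤ r → ϱhat r = ϱ r
  strictMonoOn : StrictMonoOn (fun r : ℝ => r ^ ϱhat r) (Set.Ioi 0)
  image_eq : (fun r : ℝ => r ^ ϱhat r) '' Set.Ioi 0 = Set.Ioi 0

/-- The inverse function `φ : (0, ∞) → (0, ∞)` of `r ↦ r ^ ϱhat r`, for a normalized `ϱhat`. -/
def phi (ϱhat : ℝ → ℝ) : ℝ → ℝ :=
  Function.invFunOn (fun r : ℝ => r ^ ϱhat r) (Set.Ioi 0)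

/-- The sequence `G_q = φ(q) ^ q / (e ρ) ^ (q / ρ)`; in particular `G_0 = 1`. -/
def G (ϱhat : ℝ → ℝ) (ρ : ℝ) (q : ℕ) : ℝ :=
  phi ϱhat q ^ q / (Real.exp 1 * ρ) ^ ((q : ℝ) / ρ)

/-- `|f z| exp (-σ |z| ^ ϱ |z|)`, with the Hermitian norm on `ℂⁿ`. -/
def weighted {n : ℕ} (ϱ : ℝ → ℝ) (σ : ℝ) (f : EuclideanSpace ℂ (Fin n) → ℂ)
    (z : EuclideanSpace ℂ (Fin n)) : ℝ :=
  ‖f z‖ * Real.exp (-(σ * ‖z‖ ^ ϱ ‖z‖))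

/-- The norm `sup_z |f z| exp (-σ |z| ^ ϱ |z|)`; it is meaningful for functions for which this
supremum is finite, that is, on `growthSubmodule`. -/
def growthNorm {n : ℕ} (ϱ : ℝ → ℝ) (σ : ℝ) (f : EuclideanSpace ℂ (Fin n) → ℂ) : ℝ :=
  ⨆ z, weighted ϱ σ f z

lemma weighted_add_le {n : ℕ} (ϱ : ℝ → ℝ) (σ : ℝ) (f g : EuclideanSpace ℂ (Fin n) → ℂ)
    (z : EuclideanSpace ℂ (Fin n)) :
    weighted ϱ σ (f + g) z ≤ weighted ϱ σ f z + weighted ϱ σ g z := by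
  unfold weighted
  rw [← add_mul]
  exact mul_le_mul_of_nonneg_right (norm_add_le _ _) (Real.exp_pos _).le

lemma weighted_smul {n : ℕ} (ϱ : ℝ → ℝ) (σ : ℝ) (c : ℂ) (f : EuclideanSpace ℂ (Fin n) → ℂ)
    (z : EuclideanSpace ℂ (Fin n)) :
    weighted ϱ σ (c • f) z = ‖c‖ * weighted ϱ σ f z := by
  simp [weighted, mul_assoc]

lemma weighted_nonneg {n : ℕ} (ϱ : ℝ → ℝ) (σ : ℝ) (f : EuclideanSpace ℂ (Fin n) → ℂ)
    (z : EuclideanSpace ℂ (Fin n)) : 0 ≤ weighted ϱ σ f z :=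
  mul_nonneg (norm_nonneg _) (Real.exp_pos _).le

/-- The vector space `A_{ϱ,σ}` of entire functions on `ℂⁿ` with finite norm. -/
def growthSubmodule (n : ℕ) (ϱ : ℝ → ℝ) (σ : ℝ) :
    Submodule ℂ (EuclideanSpace ℂ (Fin n) → ℂ) where
  carrier := {f | Differentiable ℂ f ∧ BddAbove (Set.range (weighted ϱ σ f))}
  zero_mem' := ⟨differentiable_const 0, 0, by rintro _ ⟨z, rfl⟩; simp [weighted]⟩
  add_mem' := by
    rintro f g ⟨hf, A, hA⟩ ⟨hg, B, hB⟩
    refine ⟨hf.add hg, A + B, ?_⟩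
    rintro _ ⟨z, rfl⟩
    exact (weighted_add_le ϱ σ f g z).trans (add_le_add (hA ⟨z, rfl⟩) (hB ⟨z, rfl⟩))
  smul_mem' := by
    rintro c f ⟨hf, A, hA⟩
    refine ⟨hf.const_smul c, ‖c‖ * A, ?_⟩
    rintro _ ⟨z, rfl⟩
    rw [weighted_smul]
    exact mul_le_mul_of_nonneg_left (hA ⟨z, rfl⟩) (norm_nonneg _)

/-- `A_{ϱ,σ}` as a type of its own, which carries the topology of `‖·‖_{ϱ,σ}` and not that of
pointwise convergence. -/
def GrowthSpace (n : ℕ) (ϱ : ℝ → ℝ) (σ : ℝ) : Type := ↥(growthSubmodule n ϱ σ)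

instance (n : ℕ) (ϱ : ℝ → ℝ) (σ : ℝ) : AddCommGroup (GrowthSpace n ϱ σ) :=
  inferInstanceAs (AddCommGroup ↥(growthSubmodule n ϱ σ))

instance (n : ℕ) (ϱ : ℝ → ℝ) (σ : ℝ) : Module ℂ (GrowthSpace n ϱ σ) :=
  inferInstanceAs (Module ℂ ↥(growthSubmodule n ϱ σ))

/-- `‖·‖_{ϱ,σ}` is a norm on `A_{ϱ,σ}`. -/
def growthAddGroupNorm (n : ℕ) (ϱ : ℝ → ℝ) (σ : ℝ) : AddGroupNorm (GrowthSpace n ϱ σ) where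
  toFun f := growthNorm ϱ σ f.1
  map_zero' := by
    show (⨆ z, weighted ϱ σ (0 : EuclideanSpace ℂ (Fin n) → ℂ) z) = 0
    simp [weighted]
  add_le' f g := by
    show (⨆ z, weighted ϱ σ (f.1 + g.1) z) ≤ growthNorm ϱ σ f.1 + growthNorm ϱ σ g.1
    exact ciSup_le fun z => (weighted_add_le ϱ σ f.1 g.1 z).trans
      (add_le_add (le_ciSup f.2.2 z) (le_ciSup g.2.2 z))
  neg' f := by
    show (⨆ z, weighted ϱ σ (-f.1) z) = ⨆ z, weighted ϱ σ f.1 z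
    simp [weighted]
  eq_zero_of_map_eq_zero' f hf := by
    refine Subtype.ext (funext fun z => ?_)
    have h1 : weighted ϱ σ f.1 z ≤ growthNorm ϱ σ f.1 := le_ciSup f.2.2 z
    have h2 : weighted ϱ σ f.1 z = 0 :=
      le_antisymm (h1.trans hf.le) (weighted_nonneg ϱ σ f.1 z)
    have h3 : f.1 z = 0 := by simpa [weighted] using h2
    exact h3

instance (n : ℕ) (ϱ : ℝ → ℝ) (σ : ℝ) : NormedAddCommGroup (GrowthSpace n ϱ σ) :=
  (growthAddGroupNorm n ϱ σ).toNormedAddCommGroup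

/-- The vector space `A_ϱ = ⋃_{σ > 0} A_{ϱ,σ}` of entire functions on `ℂⁿ` of at most normal type
with respect to `ϱ`. -/
def normalTypeSubmodule (n : ℕ) (ϱ : ℝ → ℝ) : Submodule ℂ (EuclideanSpace ℂ (Fin n) → ℂ) where
  carrier := {f | ∃ σ : ℝ, 0 < σ ∧ f ∈ growthSubmodule n ϱ σ}
  zero_mem' := ⟨1, one_pos, Submodule.zero_mem _⟩
  add_mem' := by
    have mono : ∀ {σ τ : ℝ} {f : EuclideanSpace ℂ (Fin n) → ℂ}, σ ≤ τ →
        f ∈ growthSubmodule n ϱ σ → f ∈ growthSubmodule n ϱ τ := by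
      rintro σ τ f hστ ⟨hf, A, hA⟩
      refine ⟨hf, A, ?_⟩
      rintro _ ⟨z, rfl⟩
      refine le_trans ?_ (hA ⟨z, rfl⟩)
      refine mul_le_mul_of_nonneg_left (Real.exp_le_exp.mpr (neg_le_neg ?_)) (norm_nonneg _)
      exact mul_le_mul_of_nonneg_right hστ (Real.rpow_nonneg (norm_nonneg z) _)
    rintro f g ⟨σ, hσ, hf⟩ ⟨τ, _, hg⟩
    exact ⟨max σ τ, lt_max_of_lt_left hσ,
      Submodule.add_mem _ (mono (le_max_left σ τ) hf) (mono (le_max_right σ τ) hg)⟩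
  smul_mem' := by
    rintro c f ⟨σ, hσ, hf⟩
    exact ⟨σ, hσ, Submodule.smul_mem _ c hf⟩

/-- `A_ϱ` as a type of its own, which carries the locally convex inductive limit topology. -/
def NormalType (n : ℕ) (ϱ : ℝ → ℝ) : Type := ↥(normalTypeSubmodule n ϱ)

instance (n : ℕ) (ϱ : ℝ → ℝ) : AddCommGroup (NormalType n ϱ) :=
  inferInstanceAs (AddCommGroup ↥(normalTypeSubmodule n ϱ))

instance (n : ℕ) (ϱ : ℝ → ℝ) : Module ℂ (NormalType n ϱ) :=
  inferInstanceAs (Module ℂ ↥(normalTypeSubmodule n ϱ))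

instance (n : ℕ) (ϱ : ℝ → ℝ) :
    CoeFun (NormalType n ϱ) (fun _ => EuclideanSpace ℂ (Fin n) → ℂ) :=
  ⟨fun f => f.1⟩

/-- The inclusion `A_{ϱ,σ} → A_ϱ`, for `σ > 0`. -/
def incl (n : ℕ) (ϱ : ℝ → ℝ) (σ : ℝ) (hσ : 0 < σ) (f : GrowthSpace n ϱ σ) : NormalType n ϱ :=
  ⟨f.1, σ, hσ, f.2⟩

/-- The locally convex inductive limit topology on `A_ϱ`: the finest of all locally convex vector
space topologies for which every inclusion `A_{ϱ,σ} → A_ϱ`, `σ > 0`, is continuous. (Mathlib orders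
topologies so that finer ones are smaller, hence the infimum.) -/
instance (n : ℕ) (ϱ : ℝ → ℝ) : TopologicalSpace (NormalType n ϱ) :=
  sInf {t : TopologicalSpace (NormalType n ϱ) |
    @IsTopologicalAddGroup _ t _ ∧ @ContinuousSMul ℂ _ _ _ t ∧
    @LocallyConvexSpace ℝ _ _ _ _ _ t ∧
    ∀ (σ : ℝ) (hσ : 0 < σ), @Continuous _ _ _ t (incl n ϱ σ hσ)}

/-- The partial derivative `∂f/∂z_i`. -/
def partialDeriv {n : ℕ} (i : Fin n) (f : EuclideanSpace ℂ (Fin n) → ℂ) :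
    EuclideanSpace ℂ (Fin n) → ℂ :=
  fun z => fderiv ℂ f z (EuclideanSpace.single i 1)

/-- `∂^α f = ∂₁^{α₁} ⋯ ∂ₙ^{αₙ} f`. -/
def multiDeriv {n : ℕ} (α : Fin n → ℕ) (f : EuclideanSpace ℂ (Fin n) → ℂ) :
    EuclideanSpace ℂ (Fin n) → ℂ :=
  (List.finRange n).foldr (fun i g => (partialDeriv i)^[α i] g) f

/-- The set `𝐃_{ϱ₁→ϱ₂}` of formal differential operators `P = ∑ a_α(z) ∂^α` with coefficients in
`A_{ϱ₂}` that satisfy the growth condition; `P` is given by its coefficients, and `ϱhat₁` is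
a normalization of `ϱ₁`, a proximate order for `ρ₁`. -/
def opClass (n : ℕ) (ϱhat₁ : ℝ → ℝ) (ρ₁ : ℝ) (ϱ₂ : ℝ → ℝ) :
    Set ((Fin n → ℕ) → NormalType n ϱ₂) :=
  {a | ∀ l : ℝ, 0 < l → ∃ σ : ℝ, 0 < σ ∧ ∃ C : ℝ, 0 < C ∧ ∀ α : Fin n → ℕ,
    (a α).1 ∈ growthSubmodule n ϱ₂ σ ∧
    growthNorm ϱ₂ σ (a α).1 ≤
      C * (G ϱhat₁ ρ₁ (∑ i, α i) / ((∏ i, (α i).factorial : ℕ) : ℝ)) * l ^ (∑ i, α i)}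

/-- `P f = g` for `P = ∑ a_α(z) ∂^α`: all terms `a_α ∂^α f` belong to `A_{ϱ₂}`, and their series
converges to `g` in the space `A_{ϱ₂}` (unconditionally). -/
def AppliesTo {n : ℕ} {ϱ₁ ϱ₂ : ℝ → ℝ} (a : (Fin n → ℕ) → NormalType n ϱ₂)
    (f : NormalType n ϱ₁) (g : NormalType n ϱ₂) : Prop :=
  ∃ u : (Fin n → ℕ) → NormalType n ϱ₂,
    (∀ α z, u α z = a α z * multiDeriv α f z) ∧ HasSum u g

end ProximateOrder

end

/-! Write V₁(r) = r^ϱ₁(r), q = |α|, and expand f at z: f(w) = ∑ ∂^α f(z)/α! · (w - z)^α. If this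
series converges in A_{ϱ₁}, a continuous linear F may be applied term by term. Evaluating at w = z
gives Ff(z) = ∑ a_α(z) ∂^α f(z) with a_α(z) = F((· - z)^α)(z)/α!. No other coefficients are
possible, since at the centre z only the derivative of index α of (w - z)^α survives.

The rest is estimates, and G_q balances two of them. By definition of φ, the normalized weight takes
the value q at φ(q). Hence Cauchy estimates on a radius comparable to φ(q) cost only geometric
factors: |∂^α f(z)| is at most α! B^q / G_q times a weight in z, with B depending on the type of f
(`exists_norm_multiDeriv_le`). Conversely, r^q ≤ G_q l^q exp(τ r^ϱhat₁(r)) for every l > 0, with τ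
depending on l (`exists_pow_le_G`), so monomials of degree q have norm O(G_q l^q) in some step
(`exists_growthNorm_monomialAt_le`). The free choice of l, which is also the λ of the operator
class, beats B. This yields convergence of Pf and of the Taylor series, and the bound on a_α.

That bound also needs F to map each step A_{ϱ₁,τ} boundedly into one step A_{ϱ₂,σ}
(`exists_norm_apply_incl_le`). A sampling argument proves this without any completeness. -/

noncomputable section

namespace ProximateOrder

/-! ### The inductive limit topology: continuity criteria and factorization through steps. -/

section Topology

variable {n : ℕ} {ϱ : ℝ → ℝ}

/-- The defining properties of the topologies in the infimum pass to the infimum, so the inductive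
limit topology is itself a member of that family. -/
instance normalType_isTopologicalAddGroup : IsTopologicalAddGroup (NormalType n ϱ) :=
  topologicalAddGroup_sInf fun _ ht => ht.1

instance normalType_continuousSMul : ContinuousSMul ℂ (NormalType n ϱ) :=
  continuousSMul_sInf fun _ ht => ht.2.1

instance normalType_locallyConvexSpace : LocallyConvexSpace ℝ (NormalType n ϱ) :=
  LocallyConvexSpace.sInf fun _ ht => ht.2.2.1

lemma continuous_incl {σ : ℝ} (hσ : 0 < σ) : Continuous (incl n ϱ σ hσ) :=
  continuous_sInf_rng.2 fun _ ht => ht.2.2.2 σ hσ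

/-- A linear map from the inductive limit is continuous if it is so on every step. -/
lemma continuous_of_continuous_comp_incl {X : Type*} [AddCommGroup X] [Module ℂ X] [Module ℝ X]
    [IsScalarTower ℝ ℂ X] [TopologicalSpace X] [IsTopologicalAddGroup X] [ContinuousSMul ℂ X]
    [LocallyConvexSpace ℝ X] (T : NormalType n ϱ →ₗ[ℂ] X)
    (hT : ∀ (σ : ℝ) (hσ : 0 < σ), Continuous fun f => T (incl n ϱ σ hσ f)) : Continuous T := by
  rw [continuous_iff_le_induced]
  refine sInf_le ⟨topologicalAddGroup_induced T, continuousSMul_induced T,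
    LocallyConvexSpace.induced (T.restrictScalars ℝ), fun σ hσ => ?_⟩
  exact continuous_induced_rng.2 (hT σ hσ)

instance growthSpace_normedSpace (σ : ℝ) : NormedSpace ℂ (GrowthSpace n ϱ σ) where
  norm_smul_le c f := by
    change (⨆ z, weighted ϱ σ (c • f.1) z) ≤ ‖c‖ * ⨆ z, weighted ϱ σ f.1 z
    refine ciSup_le fun z => ?_
    rw [weighted_smul]
    exact mul_le_mul_of_nonneg_left (le_ciSup f.2.2 z) (norm_nonneg c)

lemma weighted_le_growthNorm {σ : ℝ} {f : EuclideanSpace ℂ (Fin n) → ℂ}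
    (hf : f ∈ growthSubmodule n ϱ σ) (z : EuclideanSpace ℂ (Fin n)) :
    weighted ϱ σ f z ≤ growthNorm ϱ σ f := le_ciSup hf.2 z

lemma weighted_le_iff {σ b : ℝ} {f : EuclideanSpace ℂ (Fin n) → ℂ}
    {z : EuclideanSpace ℂ (Fin n)} :
    weighted ϱ σ f z ≤ b ↔ ‖f z‖ ≤ b * Real.exp (σ * ‖z‖ ^ ϱ ‖z‖) := by
  rw [weighted, Real.exp_neg, ← div_eq_mul_inv, div_le_iff₀ (Real.exp_pos _)]

lemma norm_le_of_mem {σ : ℝ} {f : EuclideanSpace ℂ (Fin n) → ℂ}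
    (hf : f ∈ growthSubmodule n ϱ σ) (z : EuclideanSpace ℂ (Fin n)) :
    ‖f z‖ ≤ growthNorm ϱ σ f * Real.exp (σ * ‖z‖ ^ ϱ ‖z‖) :=
  weighted_le_iff.1 (weighted_le_growthNorm hf z)

lemma mem_growthSubmodule_of_le {σ b : ℝ} {f : EuclideanSpace ℂ (Fin n) → ℂ}
    (hf : Differentiable ℂ f) (h : ∀ z, ‖f z‖ ≤ b * Real.exp (σ * ‖z‖ ^ ϱ ‖z‖)) :
    f ∈ growthSubmodule n ϱ σ :=
  ⟨hf, b, by rintro _ ⟨z, rfl⟩; exact weighted_le_iff.2 (h z)⟩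

lemma growthNorm_le_of_le {σ b : ℝ} {f : EuclideanSpace ℂ (Fin n) → ℂ}
    (h : ∀ z, ‖f z‖ ≤ b * Real.exp (σ * ‖z‖ ^ ϱ ‖z‖)) : growthNorm ϱ σ f ≤ b :=
  ciSup_le fun z => weighted_le_iff.2 (h z)

lemma growthNorm_nonneg (σ : ℝ) (f : EuclideanSpace ℂ (Fin n) → ℂ) : 0 ≤ growthNorm ϱ σ f :=
  Real.iSup_nonneg fun z => weighted_nonneg ϱ σ f z

/-- The inclusion `A_{ϱ,σ} → A_ϱ` as a linear map. -/
def inclLinear (n : ℕ) (ϱ : ℝ → ℝ) (σ : ℝ) (hσ : 0 < σ) :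
    GrowthSpace n ϱ σ →ₗ[ℂ] NormalType n ϱ where
  toFun := incl n ϱ σ hσ
  map_add' _ _ := rfl
  map_smul' _ _ := rfl

/-- Evaluation at `z` as a linear functional on `A_ϱ`. -/
def evalLinear (n : ℕ) (ϱ : ℝ → ℝ) (z : EuclideanSpace ℂ (Fin n)) : NormalType n ϱ →ₗ[ℂ] ℂ where
  toFun f := f z
  map_add' _ _ := rfl
  map_smul' _ _ := rfl

/-- Evaluation at `z` as a continuous linear functional on `A_ϱ`. -/
def evalCLM (n : ℕ) (ϱ : ℝ → ℝ) (z : EuclideanSpace ℂ (Fin n)) : NormalType n ϱ →L[ℂ] ℂ where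
  toLinearMap := evalLinear n ϱ z
  cont := by
    refine continuous_of_continuous_comp_incl _ fun σ hσ => ?_
    refine ((evalLinear n ϱ z ∘ₗ inclLinear n ϱ σ hσ).mkContinuous
      (Real.exp (σ * ‖z‖ ^ ϱ ‖z‖)) fun f => ?_).continuous
    rw [mul_comm]
    exact norm_le_of_mem f.2 z

@[simp] lemma evalCLM_apply (z : EuclideanSpace ℂ (Fin n)) (f : NormalType n ϱ) :
    evalCLM n ϱ z f = f z := rfl

lemma NormalType.ext {f g : NormalType n ϱ} (h : ∀ z, f z = g z) : f = g :=
  Subtype.ext (funext h)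

lemma NormalType.differentiable (f : NormalType n ϱ) : Differentiable ℂ f.1 := by
  obtain ⟨σ, _, hf⟩ := f.2
  exact hf.1

/-- The weighted evaluations at a sequence of points, with weights that decrease faster than
every weight of the inductive system. -/
def sampling (n : ℕ) (ϱ : ℝ → ℝ) (p : ℕ → EuclideanSpace ℂ (Fin n)) :
    NormalType n ϱ →ₗ[ℂ] (ℕ → ℂ) where
  toFun f k := f (p k) * (Real.exp (-((k + 1) * ‖p k‖ ^ ϱ ‖p k‖)) : ℝ)
  map_add' f g := by
    ext k
    exact add_mul _ _ _
  map_smul' c f := by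
    ext k
    exact mul_assoc _ _ _

/-- For k ≥ σ the sampling weight of type k + 1 beats the growth of type σ. Only finitely many k
remain, and their growth factors are simply added to the constant. -/
lemma exists_norm_sampling_incl_le (p : ℕ → EuclideanSpace ℂ (Fin n)) (σ : ℝ) (hσ : 0 < σ) :
    ∃ B : ℝ, 0 ≤ B ∧ ∀ (f : GrowthSpace n ϱ σ) (k : ℕ),
      ‖sampling n ϱ p (incl n ϱ σ hσ f) k‖ ≤ B * ‖f‖ := by
  refine ⟨1 + ∑ k ∈ Finset.range ⌈σ⌉₊, Real.exp (σ * ‖p k‖ ^ ϱ ‖p k‖), by positivity,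
    fun f k => ?_⟩
  have hV : 0 ≤ ‖p k‖ ^ ϱ ‖p k‖ := Real.rpow_nonneg (norm_nonneg _) _
  have h1 : ‖sampling n ϱ p (incl n ϱ σ hσ f) k‖ ≤
      ‖f‖ * Real.exp (σ * ‖p k‖ ^ ϱ ‖p k‖) * Real.exp (-((k + 1) * ‖p k‖ ^ ϱ ‖p k‖)) := by
    change ‖f.1 (p k) * (Real.exp (-((k + 1) * ‖p k‖ ^ ϱ ‖p k‖)) : ℝ)‖ ≤ _
    rw [norm_mul, Complex.norm_real, Real.norm_of_nonneg (Real.exp_pos _).le]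
    exact mul_le_mul_of_nonneg_right (norm_le_of_mem f.2 _) (Real.exp_pos _).le
  have h2 : Real.exp (σ * ‖p k‖ ^ ϱ ‖p k‖) * Real.exp (-((k + 1) * ‖p k‖ ^ ϱ ‖p k‖)) ≤
      1 + ∑ k ∈ Finset.range ⌈σ⌉₊, Real.exp (σ * ‖p k‖ ^ ϱ ‖p k‖) := by
    by_cases hk : k < ⌈σ⌉₊
    · have h3 : Real.exp (σ * ‖p k‖ ^ ϱ ‖p k‖) ≤
          ∑ k ∈ Finset.range ⌈σ⌉₊, Real.exp (σ * ‖p k‖ ^ ϱ ‖p k‖) :=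
        Finset.single_le_sum (f := fun k => Real.exp (σ * ‖p k‖ ^ ϱ ‖p k‖))
          (fun i _ => (Real.exp_pos _).le) (Finset.mem_range.2 hk)
      have h4 : Real.exp (-((k + 1) * ‖p k‖ ^ ϱ ‖p k‖)) ≤ 1 := by
        rw [Real.exp_le_one_iff]
        have : 0 ≤ ((k : ℝ) + 1) * ‖p k‖ ^ ϱ ‖p k‖ := by positivity
        linarith
      have := mul_le_mul_of_nonneg_left h4 (Real.exp_pos (σ * ‖p k‖ ^ ϱ ‖p k‖)).le
      linarith
    · have h3 : σ ≤ k := (Nat.le_ceil σ).trans (by exact_mod_cast not_lt.1 hk)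
      rw [← Real.exp_add]
      have h4 : Real.exp (σ * ‖p k‖ ^ ϱ ‖p k‖ + -((k + 1) * ‖p k‖ ^ ϱ ‖p k‖)) ≤ 1 := by
        rw [Real.exp_le_one_iff]
        nlinarith
      have : 0 ≤ ∑ k ∈ Finset.range ⌈σ⌉₊, Real.exp (σ * ‖p k‖ ^ ϱ ‖p k‖) := by positivity
      linarith
  calc _ ≤ _ := h1
    _ = ‖f‖ * (Real.exp (σ * ‖p k‖ ^ ϱ ‖p k‖) * Real.exp (-((k + 1) * ‖p k‖ ^ ϱ ‖p k‖))) := by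
      ring
    _ ≤ ‖f‖ * _ := mul_le_mul_of_nonneg_left h2 (norm_nonneg f)
    _ = _ := mul_comm _ _

lemma sampling_bounded (p : ℕ → EuclideanSpace ℂ (Fin n)) (f : NormalType n ϱ) :
    ∃ B : ℝ, ∀ k, ‖sampling n ϱ p f k‖ ≤ B := by
  obtain ⟨f, σ, hσ, hf⟩ := f
  obtain ⟨B, -, hB⟩ := exists_norm_sampling_incl_le (ϱ := ϱ) p σ hσ
  exact ⟨_, hB ⟨f, hf⟩⟩

/-- `sampling` as a linear map into the bounded sequences. -/
def samplingLinear (n : ℕ) (ϱ : ℝ → ℝ) (p : ℕ → EuclideanSpace ℂ (Fin n)) :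
    NormalType n ϱ →ₗ[ℂ] BoundedContinuousFunction ℕ ℂ where
  toFun f := BoundedContinuousFunction.ofNormedAddCommGroupDiscrete (sampling n ϱ p f)
    (sampling_bounded p f).choose (sampling_bounded p f).choose_spec
  map_add' f g := by
    ext k
    exact congrFun ((sampling n ϱ p).map_add f g) k
  map_smul' c f := by
    ext k
    exact congrFun ((sampling n ϱ p).map_smul c f) k

/-- `sampling` as a continuous linear map into the bounded sequences. -/
def samplingCLM (n : ℕ) (ϱ : ℝ → ℝ) (p : ℕ → EuclideanSpace ℂ (Fin n)) :
    NormalType n ϱ →L[ℂ] BoundedContinuousFunction ℕ ℂ where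
  toLinearMap := samplingLinear n ϱ p
  cont := by
    refine continuous_of_continuous_comp_incl (samplingLinear n ϱ p) fun σ hσ => ?_
    obtain ⟨B, hB0, hB⟩ := exists_norm_sampling_incl_le (ϱ := ϱ) p σ hσ
    refine ((samplingLinear n ϱ p ∘ₗ inclLinear n ϱ σ hσ).mkContinuous B fun f => ?_).continuous
    exact (BoundedContinuousFunction.norm_le (by positivity)).2 (hB f)

/-- A continuous linear map between inductive limits maps every step boundedly into some step. -/
lemma exists_norm_apply_incl_le {ϱ₁ ϱ₂ : ℝ → ℝ} (F : NormalType n ϱ₁ →L[ℂ] NormalType n ϱ₂)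
    {τ : ℝ} (hτ : 0 < τ) :
    ∃ σ : ℝ, 0 < σ ∧ ∃ C : ℝ, 0 < C ∧ ∀ (f : GrowthSpace n ϱ₁ τ) (z : EuclideanSpace ℂ (Fin n)),
      ‖F (incl n ϱ₁ τ hτ f) z‖ ≤ C * ‖f‖ * Real.exp (σ * ‖z‖ ^ ϱ₂ ‖z‖) := by
  -- Failure for type and constant k + 1 yields functions `f k` and points `p k`. Sampling at these
  -- points turns `F` on the step into a bounded operator `S` between normed spaces. Its weight of
  -- index k is exactly the one of type k + 1, so any k ≥ ‖S‖ gives a contradiction.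
  by_contra! hcon
  have h (k : ℕ) := hcon (k + 1) (by positivity) (k + 1) (by positivity)
  choose f p hfp using h
  let inc : GrowthSpace n ϱ₁ τ →L[ℂ] NormalType n ϱ₁ := ⟨inclLinear n ϱ₁ τ hτ, continuous_incl hτ⟩
  let S : GrowthSpace n ϱ₁ τ →L[ℂ] BoundedContinuousFunction ℕ ℂ :=
    (samplingCLM n ϱ₂ p).comp (F.comp inc)
  obtain ⟨k, hk⟩ := exists_nat_ge ‖S‖
  have h1 : ‖S (f k) k‖ ≤ ‖S‖ * ‖f k‖ :=
    ((S (f k)).norm_coe_le_norm k).trans (S.le_opNorm (f k))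
  have h2 : S (f k) k = F (incl n ϱ₁ τ hτ (f k)) (p k) *
    (Real.exp (-((k + 1) * ‖p k‖ ^ ϱ₂ ‖p k‖)) : ℝ) := rfl
  rw [h2, norm_mul, Complex.norm_real, Real.norm_of_nonneg (Real.exp_pos _).le, Real.exp_neg,
    ← div_eq_mul_inv, div_le_iff₀ (Real.exp_pos _)] at h1
  have h3 := (hfp k).trans_le h1
  rw [mul_lt_mul_iff_left₀ (Real.exp_pos _)] at h3
  have h4 : ‖S‖ * ‖f k‖ ≤ (k + 1) * ‖f k‖ :=
    mul_le_mul_of_nonneg_right (by linarith) (norm_nonneg _)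
  linarith

/-- A series of functions in `A_{ϱ,σ}` with summable norms converges to its pointwise sum. -/
lemma hasSum_growthSpace {ι : Type*} {σ : ℝ} {u : ι → GrowthSpace n ϱ σ} {b : ι → ℝ}
    (hb : Summable b) (hub : ∀ i, ‖u i‖ ≤ b i) (g : GrowthSpace n ϱ σ)
    (hg : ∀ z, HasSum (fun i => (u i).1 z) (g.1 z)) : HasSum u g := by
  -- The remainder after `s` is pointwise the sum over the complement, so its norm is at most a tail
  -- of `∑ b`. Since the limit `g` is given, completeness of the step plays no role.
  have hsub (s : Finset ι) : ‖(∑ i ∈ s, u i) - g‖ ≤ ∑' i : {i // i ∉ s}, b i := by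
    refine growthNorm_le_of_le fun z => ?_
    let ev : GrowthSpace n ϱ σ →ₗ[ℂ] ℂ :=
      { toFun := fun f => f.1 z, map_add' := fun _ _ => rfl, map_smul' := fun _ _ => rfl }
    have h1 : ((∑ i ∈ s, u i) - g).1 z = ∑ i ∈ s, (u i).1 z - g.1 z := by
      change ev ((∑ i ∈ s, u i) - g) = _
      rw [map_sub, map_sum]
      rfl
    have h2 : ∑' i : {i // i ∉ s}, (u i).1 z = g.1 z - ∑ i ∈ s, (u i).1 z := by
      rw [← (hg z).tsum_eq, ← (hg z).summable.sum_add_tsum_subtype_compl s]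
      ring
    have hb' : Summable fun i : {i // i ∉ s} => b i * Real.exp (σ * ‖z‖ ^ ϱ ‖z‖) :=
      (hb.subtype _).mul_right _
    rw [h1, ← norm_neg, neg_sub, ← h2, ← tsum_mul_right]
    refine tsum_of_norm_bounded hb'.hasSum fun i => (norm_le_of_mem (u i).2 z).trans ?_
    exact mul_le_mul_of_nonneg_right (hub i) (Real.exp_pos _).le
  rw [HasSum, tendsto_iff_norm_sub_tendsto_zero]
  exact squeeze_zero (fun _ => norm_nonneg _) hsub (tendsto_tsum_compl_atTop_zero b)

lemma hasSum_incl {ι : Type*} {σ : ℝ} (hσ : 0 < σ) {u : ι → GrowthSpace n ϱ σ}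
    {g : GrowthSpace n ϱ σ} (h : HasSum u g) :
    HasSum (fun i => incl n ϱ σ hσ (u i)) (incl n ϱ σ hσ g) :=
  h.map (inclLinear n ϱ σ hσ) (continuous_incl hσ)

end Topology

/-! ### Entire functions of several variables: Cauchy estimates, Taylor series, derivatives of
monomials. -/

section SeveralVariables

/-- The Cauchy estimate for the Fréchet derivative. -/
lemma norm_fderiv_le_of_forall_ball {E : Type*} [NormedAddCommGroup E] [NormedSpace ℂ E]
    {f : E → ℂ} (hf : Differentiable ℂ f) {c : E} {R M : ℝ} (hR : 0 < R)
    (hM : ∀ w ∈ Metric.ball c R, ‖f w‖ ≤ M) : ‖fderiv ℂ f c‖ ≤ 2 * M / R := by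
  refine Complex.norm_fderiv_le_div_of_mapsTo_ball hf.differentiableOn (fun w hw => ?_) hR
  rw [mem_closedBall_iff_norm]
  have := norm_sub_le (f w) (f c)
  linarith [hM w hw, hM c (Metric.mem_ball_self hR)]

lemma exists_norm_le_closedBall {E : Type*} [NormedAddCommGroup E] [ProperSpace E]
    {f : E → ℂ} (hf : Continuous f) (c : E) (R : ℝ) :
    ∃ M, 0 ≤ M ∧ ∀ w ∈ Metric.closedBall c R, ‖f w‖ ≤ M := by
  obtain ⟨M, hM⟩ := (isCompact_closedBall c R).exists_bound_of_continuousOn hf.continuousOn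
  exact ⟨max M 0, le_max_right _ _, fun w hw => (hM w hw).trans (le_max_left _ _)⟩

/-- A locally uniformly convergent series of entire functions of several variables is entire. -/
lemma differentiable_tsum_of_forall_ball {E ι : Type*} [NormedAddCommGroup E] [NormedSpace ℂ E]
    {u : ι → E → ℂ} (hu : ∀ i, Differentiable ℂ (u i))
    (hb : ∀ R : ℝ, ∃ b : ι → ℝ, Summable b ∧ ∀ i, ∀ z ∈ Metric.ball (0 : E) R, ‖u i z‖ ≤ b i) :
    Differentiable ℂ fun z => ∑' i, u i z := by
  intro x
  -- Points of the ball of radius ‖x‖ + 1 keep a unit ball inside radius ‖x‖ + 2, so Cauchy's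
  -- estimate with radius 1 bounds the derivatives by 2 * b.
  obtain ⟨b, hbs, hb⟩ := hb (‖x‖ + 2)
  have hx : x ∈ Metric.ball (0 : E) (‖x‖ + 1) := by simp
  refine (hasFDerivAt_tsum_of_isPreconnected (f' := fun i z => fderiv ℂ (u i) z)
    (hbs.mul_left 2) Metric.isOpen_ball
    (convex_ball (0 : E) (‖x‖ + 1)).isPreconnected (fun i z _ => (hu i z).hasFDerivAt)
    (fun i z hz => ?_) hx ?_ hx).differentiableAt
  · refine (norm_fderiv_le_of_forall_ball (hu i) one_pos fun w hw => hb i w ?_).trans_eq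
      (div_one _)
    rw [mem_ball_zero_iff] at hz ⊢
    rw [mem_ball_iff_norm] at hw
    have := norm_add_le (w - z) z
    rw [sub_add_cancel] at this
    linarith
  · exact hbs.of_norm_bounded fun i => hb i x (by simp)

lemma hasDerivAt_comp_line {E : Type*} [NormedAddCommGroup E] [NormedSpace ℂ E]
    {f : E → ℂ} (hf : Differentiable ℂ f) (p e : E) (t : ℂ) :
    HasDerivAt (fun s : ℂ => f (p + s • e)) (fderiv ℂ f (p + t • e) e) t := by
  have h : HasDerivAt (fun s : ℂ => p + s • e) e t := by
    simpa using ((hasDerivAt_id t).smul_const e).const_add p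
  exact (hf (p + t • e)).hasFDerivAt.comp_hasDerivAt t h

/-- Directional derivatives of entire functions of several variables are entire. -/
lemma differentiable_fderiv_apply {E : Type*} [NormedAddCommGroup E] [NormedSpace ℂ E]
    [FiniteDimensional ℂ E] {f : E → ℂ} (hf : Differentiable ℂ f) (e : E) :
    Differentiable ℂ fun z => fderiv ℂ f z e := by
  have := FiniteDimensional.proper ℂ E
  let c : ℝ → ℂ := fun θ => deriv (circleMap 0 1) θ * (1 / (circleMap 0 1 θ - 0) ^ 2)
  have hc : Continuous c := by
    simp only [c, deriv_circleMap, sub_zero]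
    refine ((continuous_circleMap 0 1).mul continuous_const).mul ?_
    exact continuous_const.div ((continuous_circleMap 0 1).pow 2) fun θ => by
      simp [circleMap]
  -- Cauchy's formula on the line z + s e expresses the derivative through values of `f` alone; it
  -- can then be differentiated in z under the integral.
  have key (z : E) : fderiv ℂ f z e = (2 * Real.pi * Complex.I)⁻¹ *
      ∫ θ in (0 : ℝ)..2 * Real.pi, c θ * f (z + circleMap 0 1 θ • e) := by
    have h1 : Differentiable ℂ fun s : ℂ => f (z + s • e) :=
      fun t => (hasDerivAt_comp_line hf z e t).differentiableAt
    have h2 := h1.differentiableOn.deriv_eq_smul_circleIntegral (c := 0) (R := 1) one_pos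
    rw [(hasDerivAt_comp_line hf z e 0).deriv, zero_smul, add_zero, circleIntegral] at h2
    simp only [smul_eq_mul, ← mul_assoc] at h2
    rw [h2, inv_mul_cancel_left₀ (by simp [Real.pi_ne_zero])]
  rw [funext key]
  refine Differentiable.const_mul (fun x => ?_) _
  obtain ⟨M, hM0, hM⟩ := exists_norm_le_closedBall hf.continuous x (‖e‖ + 2)
  have hmc (z : E) : Continuous fun θ => z + circleMap 0 1 θ • e :=
    continuous_const.add ((continuous_circleMap 0 1).smul continuous_const)
  have hcont (z : E) : Continuous fun θ => c θ * f (z + circleMap 0 1 θ • e) :=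
    hc.mul (hf.continuous.comp (hmc z))
  borelize E
  borelize (E →L[ℂ] ℂ)
  -- Continuity of `fderiv ℂ f` is not yet known; its measurability and the Cauchy bound suffice for
  -- dominated differentiation.
  refine (intervalIntegral.hasFDerivAt_integral_of_dominated_of_fderiv_le
    (F' := fun z θ => c θ • fderiv ℂ f (z + circleMap 0 1 θ • e))
    (bound := fun θ => ‖c θ‖ * (2 * M / 1))
    (Metric.ball_mem_nhds x one_pos)
    (Eventually.of_forall fun z => (hcont z).aestronglyMeasurable)
    ((hcont x).intervalIntegrable _ _) ?_ ?_ ?_ ?_).differentiableAt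
  · exact hc.aestronglyMeasurable.smul
      ((measurable_fderiv ℂ f).comp (hmc x).measurable).aestronglyMeasurable
  · refine Eventually.of_forall fun θ _ z hz => ?_
    rw [norm_smul]
    refine mul_le_mul_of_nonneg_left ?_ (norm_nonneg _)
    refine norm_fderiv_le_of_forall_ball hf one_pos fun w hw => hM w ?_
    rw [mem_ball_iff_norm] at hw hz
    rw [mem_closedBall_iff_norm]
    have h1 : w - x = (w - (z + circleMap 0 1 θ • e)) + (z - x) + circleMap 0 1 θ • e := by
      abel
    have h2 : ‖circleMap 0 1 θ • e‖ = ‖e‖ := by simp [norm_smul]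
    rw [h1]
    have := norm_add₃_le (a := w - (z + circleMap 0 1 θ • e)) (b := z - x)
      (c := circleMap 0 1 θ • e)
    linarith
  · exact (hc.norm.mul continuous_const).intervalIntegrable _ _
  · refine Eventually.of_forall fun θ _ z _ => ?_
    have h1 : HasFDerivAt (fun z : E => f (z + circleMap 0 1 θ • e))
        (fderiv ℂ f (z + circleMap 0 1 θ • e)) z := by
      have h := (hf (z + circleMap 0 1 θ • e)).hasFDerivAt.comp z
        ((hasFDerivAt_id z).add_const (circleMap 0 1 θ • e))
      rwa [ContinuousLinearMap.comp_id] at h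
    exact h1.const_mul (c θ)

variable {n : ℕ}

lemma differentiable_partialDeriv {f : EuclideanSpace ℂ (Fin n) → ℂ} (hf : Differentiable ℂ f)
    (i : Fin n) : Differentiable ℂ (partialDeriv i f) :=
  differentiable_fderiv_apply hf _

lemma differentiable_iterate_partialDeriv {f : EuclideanSpace ℂ (Fin n) → ℂ}
    (hf : Differentiable ℂ f) (i : Fin n) (k : ℕ) :
    Differentiable ℂ ((partialDeriv i)^[k] f) := by
  induction k with
  | zero => exact hf
  | succ k ih =>
    rw [Function.iterate_succ_apply']
    exact differentiable_partialDeriv ih i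

/-- This reduces repeated differentiation in one coordinate to the one-variable theory on a
coordinate line. -/
lemma iteratedDeriv_comp_line {f : EuclideanSpace ℂ (Fin n) → ℂ} (hf : Differentiable ℂ f)
    (i : Fin n) (p : EuclideanSpace ℂ (Fin n)) (k : ℕ) :
    iteratedDeriv k (fun t : ℂ => f (p + t • EuclideanSpace.single i 1)) =
      fun t => ((partialDeriv i)^[k] f) (p + t • EuclideanSpace.single i 1) := by
  induction k generalizing f with
  | zero => simp
  | succ k ih =>
    rw [iteratedDeriv_succ', Function.iterate_succ_apply, ← ih (differentiable_partialDeriv hf i)]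
    congr 1
    funext t
    exact (hasDerivAt_comp_line hf p _ t).deriv

lemma norm_iterate_partialDeriv_le {f : EuclideanSpace ℂ (Fin n) → ℂ} (hf : Differentiable ℂ f)
    (i : Fin n) (p : EuclideanSpace ℂ (Fin n)) (k : ℕ) {s C : ℝ} (hs : 0 < s)
    (hC : ∀ t : ℂ, ‖t‖ = s → ‖f (p + t • EuclideanSpace.single i 1)‖ ≤ C) :
    ‖((partialDeriv i)^[k] f) p‖ ≤ k.factorial * C / s ^ k := by
  have h1 : Differentiable ℂ fun t : ℂ => f (p + t • EuclideanSpace.single i 1) :=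
    fun t => (hasDerivAt_comp_line hf p _ t).differentiableAt
  have h2 := Complex.norm_iteratedDeriv_le_of_forall_mem_sphere_norm_le (c := 0) k hs
    h1.diffContOnCl fun t ht => hC t (mem_sphere_zero_iff_norm.1 ht)
  rw [iteratedDeriv_comp_line hf] at h2
  simpa using h2

lemma hasSum_taylor_line {f : EuclideanSpace ℂ (Fin n) → ℂ} (hf : Differentiable ℂ f)
    (i : Fin n) (p : EuclideanSpace ℂ (Fin n)) (t : ℂ) :
    HasSum (fun k : ℕ => t ^ k / k.factorial * ((partialDeriv i)^[k] f) p)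
      (f (p + t • EuclideanSpace.single i 1)) := by
  have h1 : Differentiable ℂ fun t : ℂ => f (p + t • EuclideanSpace.single i 1) :=
    fun t => (hasDerivAt_comp_line hf p _ t).differentiableAt
  have h2 := Complex.hasSum_taylorSeries_of_entire h1 0 t
  simp only [iteratedDeriv_comp_line hf, sub_zero, zero_smul, add_zero, smul_eq_mul] at h2
  refine h2.congr_fun fun k => ?_
  ring

/-- `∂_{ι 0}^{α 0} ⋯ ∂_{ι (m - 1)}^{α (m - 1)} f`. -/
def iterPartial {m : ℕ} (ι : Fin m → Fin n) (α : Fin m → ℕ)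
    (f : EuclideanSpace ℂ (Fin n) → ℂ) : EuclideanSpace ℂ (Fin n) → ℂ :=
  (List.finRange m).foldr (fun i g => (partialDeriv (ι i))^[α i] g) f

/-- The number m of differentiated variables is decoupled from n through `ι`, so that inductions on
m can run in a fixed space ℂⁿ; this is their inductive step. -/
lemma iterPartial_cons {m : ℕ} (ι : Fin (m + 1) → Fin n) (k : ℕ) (β : Fin m → ℕ)
    (f : EuclideanSpace ℂ (Fin n) → ℂ) :
    iterPartial ι (Fin.cons k β) f =
      (partialDeriv (ι 0))^[k] (iterPartial (fun i => ι i.succ) β f) := by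
  simp [iterPartial, List.finRange_succ, List.foldr_map]

lemma differentiable_iterPartial {m : ℕ} (ι : Fin m → Fin n) (α : Fin m → ℕ)
    {f : EuclideanSpace ℂ (Fin n) → ℂ} (hf : Differentiable ℂ f) :
    Differentiable ℂ (iterPartial ι α f) := by
  induction m with
  | zero => simpa [iterPartial] using hf
  | succ m ih =>
    rw [← Fin.cons_self_tail α, iterPartial_cons]
    exact differentiable_iterate_partialDeriv (ih _ _) _ _

/-- The Cauchy estimates in several variables. -/
lemma norm_iterPartial_le {m : ℕ} (ι : Fin m → Fin n) (α : Fin m → ℕ)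
    {f : EuclideanSpace ℂ (Fin n) → ℂ} (hf : Differentiable ℂ f)
    (p : EuclideanSpace ℂ (Fin n)) {s M : ℝ} (hs : 0 < s)
    (hM : ∀ w, ‖w - p‖ ≤ m * s → ‖f w‖ ≤ M) :
    ‖iterPartial ι α f p‖ ≤ (∏ i, (α i).factorial : ℕ) * M / s ^ ∑ i, α i := by
  induction m generalizing p with
  | zero => simpa [iterPartial] using hM p (by simp)
  | succ m ih =>
    obtain ⟨k, β, rfl⟩ : ∃ k β, α = Fin.cons k β := ⟨α 0, Fin.tail α, (Fin.cons_self_tail α).symm⟩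
    rw [iterPartial_cons]
    refine (norm_iterate_partialDeriv_le (differentiable_iterPartial _ _ hf) (ι 0) p k hs
      fun t ht => ih (fun i => ι i.succ) β _ fun w hw => hM w ?_).trans_eq ?_
    · have h1 : w - p = (w - (p + t • EuclideanSpace.single (ι 0) (1 : ℂ))) +
          t • EuclideanSpace.single (ι 0) (1 : ℂ) := by abel
      have h2 : ‖t • EuclideanSpace.single (ι 0) (1 : ℂ)‖ = s := by simp [norm_smul, ht]
      rw [h1]
      refine (norm_add_le _ _).trans ?_
      rw [h2]
      push_cast
      linarith
    · rw [Fin.prod_univ_succ, Fin.sum_univ_succ]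
      simp only [Fin.cons_zero, Fin.cons_succ, pow_add, Nat.cast_mul]
      field_simp

/-- Splitting off one coordinate exhibits a product of geometric series. -/
lemma summable_pow_sum (m : ℕ) {x : ℝ} (hx0 : 0 ≤ x) (hx1 : x < 1) :
    Summable fun α : Fin m → ℕ => x ^ ∑ i, α i := by
  induction m with
  | zero => exact (hasSum_unique _).summable
  | succ m ih =>
    rw [← (Fin.consEquiv fun _ => ℕ).summable_iff]
    have := (summable_geometric_of_lt_one hx0 hx1).mul_of_nonneg ih
      (fun k => pow_nonneg hx0 k) (fun β => pow_nonneg hx0 _)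
    refine this.congr fun q => ?_
    simp [Fin.consEquiv, Fin.sum_univ_succ, pow_add]

/-- The Taylor expansion of an entire function of several variables. -/
lemma hasSum_taylor_iterPartial {m : ℕ} (ι : Fin m → Fin n)
    {f : EuclideanSpace ℂ (Fin n) → ℂ} (hf : Differentiable ℂ f)
    (p : EuclideanSpace ℂ (Fin n)) (v : Fin m → ℂ) :
    HasSum (fun α : Fin m → ℕ => (∏ i, v i ^ α i / (α i).factorial) * iterPartial ι α f p)
      (f (p + ∑ i, v i • EuclideanSpace.single (ι i) 1)) := by
  induction m generalizing p with
  | zero => simp [iterPartial]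
  | succ m ih =>
    have hsum : Summable fun α : Fin (m + 1) → ℕ =>
        (∏ i, v i ^ α i / (α i).factorial) * iterPartial ι α f p := by
      -- Since ‖v i‖ ≤ s / 2, Cauchy estimates with radius `s` bound each term by M / 2^|α|.
      let s : ℝ := 2 * (1 + ∑ i, ‖v i‖)
      have hv0 : 0 ≤ ∑ i, ‖v i‖ := by positivity
      have hs : 0 < s := by positivity
      obtain ⟨M, hM0, hM⟩ := exists_norm_le_closedBall hf.continuous p ((m + 1 : ℕ) * s)
      refine ((summable_pow_sum (m + 1) (x := 1 / 2) (by norm_num) (by norm_num)).mul_right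
        M).of_norm_bounded fun α => ?_
      have h1 := norm_iterPartial_le ι α hf p hs fun w hw => hM w (mem_closedBall_iff_norm.2 hw)
      have h2 : ‖∏ i, v i ^ α i / (α i).factorial‖ ≤
          ∏ i, (s / 2) ^ α i / (α i).factorial := by
        rw [norm_prod]
        refine Finset.prod_le_prod (fun i _ => norm_nonneg _) fun i _ => ?_
        rw [norm_div, norm_pow, Complex.norm_natCast]
        have : ‖v i‖ ≤ ∑ i, ‖v i‖ :=
          Finset.single_le_sum (f := fun i => ‖v i‖) (fun i _ => norm_nonneg _)
            (Finset.mem_univ i)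
        gcongr
        simp only [s]
        linarith
      rw [norm_mul]
      refine (mul_le_mul h2 h1 (norm_nonneg _) (by positivity)).trans_eq ?_
      rw [Finset.prod_div_distrib, Finset.prod_pow_eq_pow_sum, ← Nat.cast_prod]
      have : ((∏ i, (α i).factorial : ℕ) : ℝ) ≠ 0 := by
        exact_mod_cast (Finset.prod_pos fun i _ => Nat.factorial_pos _).ne'
      rw [div_pow, one_div, inv_pow]
      field_simp
    -- The exponent of the first variable becomes the inner index. The inner sum is a Taylor series
    -- on a line and moves the centre `p` by `v 0` in direction `ι 0`; the outer sum is the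
    -- induction hypothesis at the new centre.
    let e : (Fin m → ℕ) × ℕ ≃ (Fin (m + 1) → ℕ) :=
      (Equiv.prodComm _ _).trans (Fin.consEquiv fun _ => ℕ)
    rw [← e.summable_iff] at hsum
    rw [← e.hasSum_iff]
    have hfib (β : Fin m → ℕ) := (hasSum_taylor_line
      (differentiable_iterPartial (fun i => ι i.succ) β hf) (ι 0) p (v 0)).mul_left
      (∏ i, v i.succ ^ β i / (β i).factorial)
    have h1 := hsum.hasSum.prod_fiberwise fun β => (hfib β).congr_fun fun k => by
      simp [e, Fin.consEquiv, iterPartial_cons, Fin.prod_univ_succ]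
      ring
    have h2 := ih (fun i => ι i.succ) (p + v 0 • EuclideanSpace.single (ι 0) 1)
      fun i => v i.succ
    have h3 := h1.unique h2
    rw [Fin.sum_univ_succ, ← add_assoc, ← h3]
    exact hsum.hasSum

lemma multiDeriv_eq_iterPartial (α : Fin n → ℕ) (f : EuclideanSpace ℂ (Fin n) → ℂ) :
    multiDeriv α f = iterPartial id α f := rfl

lemma differentiable_multiDeriv (α : Fin n → ℕ) {f : EuclideanSpace ℂ (Fin n) → ℂ}
    (hf : Differentiable ℂ f) : Differentiable ℂ (multiDeriv α f) :=
  differentiable_iterPartial id α hf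

/-- The monomial `(w - z)^α`. -/
def monomialAt (z : EuclideanSpace ℂ (Fin n)) (α : Fin n → ℕ)
    (w : EuclideanSpace ℂ (Fin n)) : ℂ := ∏ i, (w i - z i) ^ α i

lemma differentiable_monomialAt (z : EuclideanSpace ℂ (Fin n)) (α : Fin n → ℕ) :
    Differentiable ℂ (monomialAt z α) := by
  unfold monomialAt
  fun_prop

/-- The Taylor expansion of an entire function on `ℂⁿ` at `z`. -/
lemma hasSum_taylor {f : EuclideanSpace ℂ (Fin n) → ℂ} (hf : Differentiable ℂ f)
    (z w : EuclideanSpace ℂ (Fin n)) :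
    HasSum (fun α : Fin n → ℕ =>
      multiDeriv α f z / (∏ i, (α i).factorial : ℕ) * monomialAt z α w) (f w) := by
  have h := hasSum_taylor_iterPartial id hf z fun i => w i - z i
  have hw : z + ∑ i, (w i - z i) • EuclideanSpace.single i (1 : ℂ) = w := by
    ext j
    simp [Finset.sum_apply, Pi.single_apply]
  simp only [id_eq] at h
  rw [hw] at h
  refine h.congr_fun fun α => ?_
  rw [Finset.prod_div_distrib, multiDeriv_eq_iterPartial, monomialAt, Nat.cast_prod]
  ring

/-- The product of polynomials in the separate variables. -/
def prodEval (q : Fin n → Polynomial ℂ) (w : EuclideanSpace ℂ (Fin n)) : ℂ :=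
  ∏ i, (q i).eval (w i)

/-- Products of polynomials in separate variables are stable under partial derivatives, which turns
differentiation of monomials into polynomial algebra. -/
lemma partialDeriv_prodEval (i : Fin n) (q : Fin n → Polynomial ℂ) :
    partialDeriv i (prodEval q) =
      prodEval (Function.update q i (Polynomial.derivative (q i))) := by
  have hd : Differentiable ℂ (prodEval q) := by
    have h (j : Fin n) : Differentiable ℂ fun w : EuclideanSpace ℂ (Fin n) => (q j).eval (w j) :=
      (q j).differentiable.comp (by fun_prop)
    unfold prodEval
    fun_prop
  funext w
  have h1 := hasDerivAt_comp_line hd w (EuclideanSpace.single i 1) 0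
  have h2 : (fun t : ℂ => prodEval q (w + t • EuclideanSpace.single i 1)) =
      fun t => (q i).eval (w i + t) * ∏ j ∈ Finset.univ.erase i, (q j).eval (w j) := by
    funext t
    rw [prodEval, ← Finset.mul_prod_erase _ _ (Finset.mem_univ i)]
    congr 1
    · simp
    · refine Finset.prod_congr rfl fun j hj => ?_
      simp [Finset.ne_of_mem_erase hj]
  have h3 : HasDerivAt (fun t : ℂ => (q i).eval (w i + t)) ((q i).derivative.eval (w i)) 0 := by
    have := (q i).hasDerivAt (w i + 0)
    simpa using this.comp_const_add (w i) 0
  rw [h2] at h1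
  have h4 := h1.unique (h3.mul_const _)
  rw [zero_smul, add_zero] at h4
  rw [partialDeriv, h4, prodEval, ← Finset.mul_prod_erase _ _ (Finset.mem_univ i)]
  congr 1
  · simp
  · refine Finset.prod_congr rfl fun j hj => ?_
    simp [Finset.ne_of_mem_erase hj]

lemma iterate_partialDeriv_prodEval (i : Fin n) (k : ℕ) (q : Fin n → Polynomial ℂ) :
    (partialDeriv i)^[k] (prodEval q) =
      prodEval (Function.update q i (Polynomial.derivative^[k] (q i))) := by
  induction k generalizing q with
  | zero => simp
  | succ k ih =>
    rw [Function.iterate_succ_apply, partialDeriv_prodEval, ih]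
    simp

lemma multiDeriv_prodEval (β : Fin n → ℕ) (q : Fin n → Polynomial ℂ) :
    multiDeriv β (prodEval q) = prodEval fun i => Polynomial.derivative^[β i] (q i) := by
  -- Without duplicates, each factor is still undifferentiated when the fold reaches its index.
  have h (l : List (Fin n)) (hl : l.Nodup) :
      l.foldr (fun i g => (partialDeriv i)^[β i] g) (prodEval q) =
        prodEval fun i => if i ∈ l then Polynomial.derivative^[β i] (q i) else q i := by
    induction l with
    | nil => simp
    | cons i l ih =>
      rw [List.nodup_cons] at hl
      rw [List.foldr_cons, ih hl.2, iterate_partialDeriv_prodEval]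
      congr 1
      funext j
      rcases eq_or_ne j i with rfl | hj
      · simp [hl.1]
      · simp [hj]
  rw [multiDeriv, h _ (List.nodup_finRange n)]
  simp

/-- At the centre `z`, the derivatives of `(w - z)^α` vanish except for the one of index `α`. -/
lemma multiDeriv_monomialAt_self (z : EuclideanSpace ℂ (Fin n)) (α β : Fin n → ℕ) :
    multiDeriv β (monomialAt z α) z = if β = α then ((∏ i, (α i).factorial : ℕ) : ℂ) else 0 := by
  have h1 : monomialAt z α =
      prodEval fun i => (Polynomial.X - Polynomial.C (z i)) ^ α i := by
    funext w
    simp [monomialAt, prodEval]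
  rw [h1, multiDeriv_prodEval, prodEval]
  split_ifs with h
  · subst h
    simp [Polynomial.iterate_derivative_X_sub_pow_self]
  · obtain ⟨i, hi⟩ := Function.ne_iff.1 h
    refine Finset.prod_eq_zero (Finset.mem_univ i) ?_
    rw [Polynomial.iterate_derivative_X_sub_pow]
    -- Too few derivatives leave a positive power of zero; too many annihilate the factor.
    rcases hi.lt_or_gt with hlt | hgt
    · simp [sub_self, zero_pow (Nat.sub_ne_zero_of_lt hlt)]
    · simp [Nat.descFactorial_of_lt hgt]

end SeveralVariables

/-! ### Growth of r^ϱ(r) under scaling and addition, and the sequence G_q. -/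

section Weights

variable {ϱ ϱhat : ℝ → ℝ} {ρ : ℝ}

namespace IsProximateOrder

/-- The function is the logarithm of r^(ϱ(r) - c). Its derivative times r tends to ρ - c, whose sign
therefore decides the eventual monotonicity. -/
lemma hasDerivAt_sub_mul_log (h : IsProximateOrder ϱ ρ) (c : ℝ) {r : ℝ} (hr : 0 < r) :
    HasDerivAt (fun r => (ϱ r - c) * Real.log r)
      (r⁻¹ * (deriv ϱ r * r * Real.log r + (ϱ r - c))) r := by
  have h1 : HasDerivAt ϱ (deriv ϱ r) r :=
    (h.differentiableOn.differentiableAt (Ici_mem_nhds hr)).hasDerivAt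
  refine ((h1.sub_const c).mul (Real.hasDerivAt_log hr.ne')).congr_deriv ?_
  field_simp

lemma tendsto_deriv_add (h : IsProximateOrder ϱ ρ) (c : ℝ) :
    Tendsto (fun r => deriv ϱ r * r * Real.log r + (ϱ r - c)) atTop (𝓝 (ρ - c)) := by
  simpa using h.tendsto_deriv.add (h.tendsto_order.sub_const c)

/-- If `c < ρ`, then `r ^ (ϱ r - c)` is eventually increasing. -/
lemma exists_rpow_mul_le (h : IsProximateOrder ϱ ρ) {c : ℝ} (hc : c < ρ) :
    ∃ s₀ : ℝ, 0 < s₀ ∧ ∀ s x, s₀ ≤ s → 1 ≤ x → x ^ c * s ^ ϱ s ≤ (x * s) ^ ϱ (x * s) := by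
  obtain ⟨s₁, hs₁⟩ := eventually_atTop.1
    ((h.tendsto_deriv_add c).eventually_const_lt (sub_pos.2 hc))
  refine ⟨max s₁ 1, by positivity, fun s x hs hx => ?_⟩
  have hs0 : 0 < s := lt_of_lt_of_le (by positivity) hs
  have hx0 : 0 < x := by linarith
  have hmono : MonotoneOn (fun r => (ϱ r - c) * Real.log r) (Set.Ici (max s₁ 1)) := by
    have hpos {r : ℝ} (hr : max s₁ 1 ≤ r) : 0 < r := lt_of_lt_of_le (by positivity) hr
    refine monotoneOn_of_deriv_nonneg (convex_Ici _)
      (fun r hr => (h.hasDerivAt_sub_mul_log c (hpos hr)).continuousAt.continuousWithinAt)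
      (fun r hr => ?_) fun r hr => ?_ <;> rw [interior_Ici] at hr
    · exact (h.hasDerivAt_sub_mul_log c (hpos hr.le)).differentiableAt.differentiableWithinAt
    · rw [(h.hasDerivAt_sub_mul_log c (hpos hr.le)).deriv]
      exact mul_nonneg (inv_nonneg.2 (hpos hr.le).le)
        (hs₁ r ((le_max_left _ _).trans hr.le)).le
  have hsx : s ≤ x * s := le_mul_of_one_le_left hs0.le hx
  have := hmono (Set.mem_Ici.2 hs) (Set.mem_Ici.2 (hs.trans hsx)) hsx
  simp only [Real.log_mul hx0.ne' hs0.ne'] at this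
  rw [Real.rpow_def_of_pos hx0, Real.rpow_def_of_pos hs0, Real.rpow_def_of_pos (mul_pos hx0 hs0),
    ← Real.exp_add, Real.exp_le_exp, Real.log_mul hx0.ne' hs0.ne']
  linarith

/-- If `ρ < c`, then `r ^ (ϱ r - c)` is eventually decreasing. -/
lemma exists_le_rpow_mul (h : IsProximateOrder ϱ ρ) {c : ℝ} (hc : ρ < c) :
    ∃ s₀ : ℝ, 0 < s₀ ∧ ∀ s x, s₀ ≤ s → 1 ≤ x → (x * s) ^ ϱ (x * s) ≤ x ^ c * s ^ ϱ s := by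
  obtain ⟨s₁, hs₁⟩ := eventually_atTop.1
    ((h.tendsto_deriv_add c).eventually_lt_const (sub_neg.2 hc))
  refine ⟨max s₁ 1, by positivity, fun s x hs hx => ?_⟩
  have hs0 : 0 < s := lt_of_lt_of_le (by positivity) hs
  have hx0 : 0 < x := by linarith
  have hanti : AntitoneOn (fun r => (ϱ r - c) * Real.log r) (Set.Ici (max s₁ 1)) := by
    have hpos {r : ℝ} (hr : max s₁ 1 ≤ r) : 0 < r := lt_of_lt_of_le (by positivity) hr
    refine antitoneOn_of_deriv_nonpos (convex_Ici _)
      (fun r hr => (h.hasDerivAt_sub_mul_log c (hpos hr)).continuousAt.continuousWithinAt)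
      (fun r hr => ?_) fun r hr => ?_ <;> rw [interior_Ici] at hr
    · exact (h.hasDerivAt_sub_mul_log c (hpos hr.le)).differentiableAt.differentiableWithinAt
    · rw [(h.hasDerivAt_sub_mul_log c (hpos hr.le)).deriv]
      exact mul_nonpos_of_nonneg_of_nonpos (inv_nonneg.2 (hpos hr.le).le)
        (hs₁ r ((le_max_left _ _).trans hr.le)).le
  have hsx : s ≤ x * s := le_mul_of_one_le_left hs0.le hx
  have := hanti (Set.mem_Ici.2 hs) (Set.mem_Ici.2 (hs.trans hsx)) hsx
  simp only [Real.log_mul hx0.ne' hs0.ne'] at this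
  rw [Real.rpow_def_of_pos hx0, Real.rpow_def_of_pos hs0, Real.rpow_def_of_pos (mul_pos hx0 hs0),
    ← Real.exp_add, Real.exp_le_exp, Real.log_mul hx0.ne' hs0.ne']
  linarith

lemma exists_rpow_le (h : IsProximateOrder ϱ ρ) (R : ℝ) :
    ∃ B : ℝ, 0 < B ∧ ∀ r, 0 ≤ r → r ≤ R → r ^ ϱ r ≤ B := by
  obtain ⟨M, hM⟩ := isCompact_Icc.exists_bound_of_continuousOn
    (h.differentiableOn.continuousOn.mono fun r (hr : r ∈ Set.Icc 0 R) => hr.1)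
  refine ⟨max 1 R ^ M, by positivity, fun r h0 hR => ?_⟩
  calc r ^ ϱ r ≤ max 1 R ^ ϱ r :=
        Real.rpow_le_rpow h0 (hR.trans (le_max_right _ _)) (h.nonneg r h0)
    _ ≤ _ := Real.rpow_le_rpow_of_exponent_le (le_max_left _ _)
        ((le_abs_self _).trans (hM r ⟨h0, hR⟩))

/-- The additive `K` covers the bounded radii, about which the O-condition says nothing. In an
exponent it costs only a constant factor, so changing weights affects just the type and the
constant. -/
lemma exists_rpow_le_of_isBigO (h : IsProximateOrder ϱ ρ) {ϱ' : ℝ → ℝ}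
    (hO : (fun r : ℝ => r ^ ϱ r) =O[atTop] fun r : ℝ => r ^ ϱ' r) :
    ∃ K : ℝ, 0 < K ∧ ∀ r, 0 ≤ r → r ^ ϱ r ≤ K * r ^ ϱ' r + K := by
  obtain ⟨c, hc⟩ := hO.bound
  obtain ⟨R, hR⟩ := eventually_atTop.1 hc
  obtain ⟨B, hB0, hB⟩ := h.exists_rpow_le R
  refine ⟨max B c, lt_max_of_lt_left hB0, fun r hr => ?_⟩
  have h1 : 0 ≤ r ^ ϱ' r := Real.rpow_nonneg hr _
  have hK : 0 < max B c := lt_max_of_lt_left hB0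
  rcases le_total r R with hrR | hrR
  · calc r ^ ϱ r ≤ B := hB r hr hrR
      _ ≤ max B c := le_max_left _ _
      _ ≤ _ := le_add_of_nonneg_left (by positivity)
  · have h2 := hR r hrR
    rw [Real.norm_of_nonneg (Real.rpow_nonneg hr _), Real.norm_of_nonneg h1] at h2
    calc r ^ ϱ r ≤ c * r ^ ϱ' r := h2
      _ ≤ max B c * r ^ ϱ' r := mul_le_mul_of_nonneg_right (le_max_right _ _) h1
      _ ≤ _ := le_add_of_nonneg_right hK.le

end IsProximateOrder

namespace IsNormalization

lemma rpow_le_rpow (h : IsNormalization ϱhat ϱ ρ) {r s : ℝ} (hr : 0 < r) (hrs : r ≤ s) :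
    r ^ ϱhat r ≤ s ^ ϱhat s :=
  h.strictMonoOn.monotoneOn hr (hr.trans_le hrs) hrs

lemma eventuallyEq (h : IsNormalization ϱhat ϱ ρ) :
    (fun r : ℝ => r ^ ϱhat r) =ᶠ[atTop] fun r => r ^ ϱ r := by
  obtain ⟨r₁, -, hr⟩ := h.eq_of_large
  filter_upwards [eventually_ge_atTop r₁] with r h1
  rw [hr r h1]

/-- Large s are covered by the eventual decrease of r^(ϱhat(r) - ρ - 1); for s between `s₁` and `s₀`
monotonicity bounds the quotient by a constant. -/
lemma exists_scale_le (h : IsNormalization ϱhat ϱ ρ) {s₁ x : ℝ} (hs₁ : 0 < s₁) (hx : 1 ≤ x) :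
    ∃ K : ℝ, 0 < K ∧ ∀ s, s₁ ≤ s → (x * s) ^ ϱhat (x * s) ≤ K * s ^ ϱhat s := by
  obtain ⟨s₀, hs₀, hU⟩ := h.isProximateOrder.exists_le_rpow_mul (lt_add_one ρ)
  have hx0 : 0 < x := by linarith
  have hV₁ : 0 < s₁ ^ ϱhat s₁ := Real.rpow_pos_of_pos hs₁ _
  have hV₀ : 0 < (x * s₀) ^ ϱhat (x * s₀) := Real.rpow_pos_of_pos (by positivity) _
  refine ⟨max (x ^ (ρ + 1)) ((x * s₀) ^ ϱhat (x * s₀) / s₁ ^ ϱhat s₁),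
    lt_max_of_lt_right (by positivity), fun s hs => ?_⟩
  have hs0 : 0 < s := hs₁.trans_le hs
  have hV : 0 < s ^ ϱhat s := Real.rpow_pos_of_pos hs0 _
  rcases le_total s₀ s with h1 | h1
  · exact (hU s x h1 hx).trans (mul_le_mul_of_nonneg_right (le_max_left _ _) hV.le)
  · calc (x * s) ^ ϱhat (x * s) ≤ (x * s₀) ^ ϱhat (x * s₀) :=
          h.rpow_le_rpow (by positivity) (by gcongr)
      _ = (x * s₀) ^ ϱhat (x * s₀) / s₁ ^ ϱhat s₁ * s₁ ^ ϱhat s₁ := by field_simp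
      _ ≤ (x * s₀) ^ ϱhat (x * s₀) / s₁ ^ ϱhat s₁ * s ^ ϱhat s := by
        gcongr
        exact h.rpow_le_rpow hs₁ hs
      _ ≤ _ := mul_le_mul_of_nonneg_right (le_max_right _ _) hV.le

/-- For s ≥ s₀ the eventual growth applies. For s < s₀, either x s ≥ s₀, and starting from `s₀`
loses at most (s₁ / s₀)^c, or x s ≤ s₀, and then κ x^c ≤ 1 and monotonicity suffices. -/
lemma exists_le_scale (h : IsNormalization ϱhat ϱ ρ) {s₁ c : ℝ} (hs₁ : 0 < s₁) (hc0 : 0 ≤ c)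
    (hc : c < ρ) :
    ∃ κ : ℝ, 0 < κ ∧ ∀ s x, s₁ ≤ s → 1 ≤ x →
      κ * x ^ c * s ^ ϱhat s ≤ (x * s) ^ ϱhat (x * s) := by
  obtain ⟨s₂, hs₂, hL₂⟩ := h.isProximateOrder.exists_rpow_mul_le hc
  obtain ⟨s₀, hs₀, hs₁₀, hL⟩ : ∃ s₀, 0 < s₀ ∧ s₁ ≤ s₀ ∧ ∀ s x, s₀ ≤ s → 1 ≤ x →
      x ^ c * s ^ ϱhat s ≤ (x * s) ^ ϱhat (x * s) :=
    ⟨max s₁ s₂, lt_max_of_lt_left hs₁, le_max_left _ _,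
      fun s x hs => hL₂ s x ((le_max_right _ _).trans hs)⟩
  refine ⟨(s₁ / s₀) ^ c, by positivity, fun s x hs hx => ?_⟩
  have hx0 : 0 < x := by linarith
  have hs0 : 0 < s := hs₁.trans_le hs
  have hV : 0 < s ^ ϱhat s := Real.rpow_pos_of_pos hs0 _
  have hκ : (s₁ / s₀) ^ c * x ^ c = (x * s₁ / s₀) ^ c := by
    rw [← Real.mul_rpow (by positivity) hx0.le]
    congr 1
    ring
  rcases le_total s₀ s with h1 | h1
  · refine le_trans ?_ (hL s x h1 hx)
    have : (s₁ / s₀) ^ c ≤ 1 :=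
      Real.rpow_le_one (by positivity) ((div_le_one hs₀).2 hs₁₀) hc0
    have := mul_le_mul_of_nonneg_right this (by positivity : 0 ≤ x ^ c * s ^ ϱhat s)
    linarith
  · rw [hκ]
    rcases le_total s₀ (x * s) with h2 | h2
    · have h3 := hL s₀ (x * s / s₀) le_rfl ((one_le_div hs₀).2 h2)
      rw [div_mul_cancel₀ _ hs₀.ne'] at h3
      refine le_trans ?_ h3
      gcongr
      exact h.rpow_le_rpow hs0 h1
    · have h3 : (x * s₁ / s₀) ^ c ≤ 1 := by
        refine Real.rpow_le_one (by positivity) ((div_le_one hs₀).2 ?_) hc0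
        exact (mul_le_mul_of_nonneg_left hs hx0.le).trans h2
      calc _ ≤ 1 * s ^ ϱhat s := mul_le_mul_of_nonneg_right h3 hV.le
        _ = s ^ ϱhat s := one_mul _
        _ ≤ _ := h.rpow_le_rpow hs0 (le_mul_of_one_le_left hs0.le hx)

/-- Since t ≤ 2 max(a, b), the doubling bound applies to the larger of the two; the additive
constant absorbs small radii. -/
lemma exists_rpow_le_of_le_add (h : IsNormalization ϱhat ϱ ρ) :
    ∃ K : ℝ, 0 < K ∧ ∀ t a b, 0 ≤ t → 0 ≤ a → 0 ≤ b → t ≤ a + b →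
      t ^ ϱhat t ≤ K * (a ^ ϱhat a + b ^ ϱhat b) + K := by
  obtain ⟨K, hK, hK'⟩ := h.exists_scale_le one_pos one_le_two
  have hV₂ : (0 : ℝ) < 2 ^ ϱhat 2 := Real.rpow_pos_of_pos two_pos _
  obtain ⟨L, hKL, h2L, h1L⟩ : ∃ L, K ≤ L ∧ (2 : ℝ) ^ ϱhat 2 ≤ L ∧ 1 ≤ L :=
    ⟨max K (max ((2 : ℝ) ^ ϱhat 2) 1), by simp, by simp, by simp⟩
  have key (s : ℝ) (hs : 0 ≤ s) (t : ℝ) (ht : 0 ≤ t) (hts : t ≤ 2 * s) :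
      t ^ ϱhat t ≤ L * s ^ ϱhat s + L := by
    have hVs : 0 ≤ s ^ ϱhat s := Real.rpow_nonneg hs _
    have hL : 0 ≤ L * s ^ ϱhat s := mul_nonneg (by linarith) hVs
    -- Monotonicity only concerns positive radii, and `0 ^ ϱhat 0` is 1 when `ϱhat 0 = 0`.
    rcases ht.eq_or_lt with rfl | ht
    · have := Real.rpow_le_one le_rfl zero_le_one (h.isProximateOrder.nonneg 0 le_rfl)
      linarith
    · rcases le_total 1 s with h1 | h1
      · calc t ^ ϱhat t ≤ (2 * s) ^ ϱhat (2 * s) := h.rpow_le_rpow ht hts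
          _ ≤ K * s ^ ϱhat s := hK' s h1
          _ ≤ L * s ^ ϱhat s := mul_le_mul_of_nonneg_right hKL hVs
          _ ≤ _ := by linarith
      · have : t ^ ϱhat t ≤ 2 ^ ϱhat 2 := h.rpow_le_rpow ht (by linarith)
        linarith
  refine ⟨L, by linarith, fun t a b ht ha hb hab => ?_⟩
  have hVa : 0 ≤ L * a ^ ϱhat a := mul_nonneg (by linarith) (Real.rpow_nonneg ha _)
  have hVb : 0 ≤ L * b ^ ϱhat b := mul_nonneg (by linarith) (Real.rpow_nonneg hb _)
  rcases le_total a b with h1 | h1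
  · have := key b hb t ht (by linarith)
    linarith
  · have := key a ha t ht (by linarith)
    linarith

lemma phi_mem (h : IsNormalization ϱhat ϱ ρ) {t : ℝ} (ht : 0 < t) : 0 < phi ϱhat t := by
  have : t ∈ (fun r : ℝ => r ^ ϱhat r) '' Set.Ioi 0 := by rw [h.image_eq]; exact ht
  exact Function.invFunOn_mem this

lemma rpow_phi (h : IsNormalization ϱhat ϱ ρ) {t : ℝ} (ht : 0 < t) :
    phi ϱhat t ^ ϱhat (phi ϱhat t) = t := by
  have : t ∈ (fun r : ℝ => r ^ ϱhat r) '' Set.Ioi 0 := by rw [h.image_eq]; exact ht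
  exact Function.invFunOn_eq this

lemma phi_le_phi (h : IsNormalization ϱhat ϱ ρ) {t u : ℝ} (ht : 0 < t) (htu : t ≤ u) :
    phi ϱhat t ≤ phi ϱhat u := by
  refine (h.strictMonoOn.le_iff_le (h.phi_mem ht) (h.phi_mem (ht.trans_le htu))).1 ?_
  simpa only [h.rpow_phi ht, h.rpow_phi (ht.trans_le htu)] using htu

/-- As a q-th power, G_q combines with geometric factors, which absorb the constant (eρ)^(1/ρ). -/
lemma G_eq (hρ : 0 < ρ) (ϱhat : ℝ → ℝ) (q : ℕ) :
    G ϱhat ρ q = (phi ϱhat q / (Real.exp 1 * ρ) ^ (1 / ρ)) ^ q := by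
  rw [G, div_pow, ← Real.rpow_mul_natCast (by positivity)]
  congr 2
  ring

lemma G_pos (h : IsNormalization ϱhat ϱ ρ) (hρ : 0 < ρ) (q : ℕ) : 0 < G ϱhat ρ q := by
  rw [G_eq hρ]
  rcases q.eq_zero_or_pos with rfl | hq
  · simp
  · have := h.phi_mem (Nat.cast_pos.2 hq : (0 : ℝ) < q)
    positivity

/-- The sequence `G_q` controls the norms of the monomials of degree `q`. -/
lemma exists_pow_le_G (h : IsNormalization ϱhat ϱ ρ) (hρ : 0 < ρ) {l : ℝ} (hl : 0 < l) :
    ∃ τ : ℝ, 0 < τ ∧ ∀ (q : ℕ) (r : ℝ), 0 ≤ r →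
      r ^ q ≤ G ϱhat ρ q * l ^ q * Real.exp (τ * r ^ ϱhat r) := by
  let μ : ℝ := l / (Real.exp 1 * ρ) ^ (1 / ρ)
  have hμ : 0 < μ := by positivity
  have hφ₁ := h.phi_mem one_pos
  obtain ⟨κ, hκ, hL⟩ := h.exists_le_scale (mul_pos hμ hφ₁) (by positivity : 0 ≤ ρ / 2)
    (by linarith)
  obtain ⟨K, hK, hU⟩ := h.exists_scale_le (mul_pos hμ hφ₁) (le_max_left 1 μ⁻¹)
  refine ⟨K / (ρ / 2 * κ), by positivity, fun q r hr => ?_⟩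
  have hVr : 0 ≤ r ^ ϱhat r := Real.rpow_nonneg hr _
  have hexp : 1 ≤ Real.exp (K / (ρ / 2 * κ) * r ^ ϱhat r) := Real.one_le_exp (by positivity)
  have hG : G ϱhat ρ q * l ^ q = (μ * phi ϱhat q) ^ q := by
    rw [G_eq hρ, ← mul_pow]
    congr 1
    simp only [μ]
    ring
  rw [hG]
  rcases q.eq_zero_or_pos with rfl | hq
  · simpa using hexp
  have hq1 : (1 : ℝ) ≤ q := by exact_mod_cast hq
  have hq0 : (0 : ℝ) < q := by linarith
  have hφ := h.phi_mem hq0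
  have hφφ := h.phi_le_phi one_pos hq1
  set t : ℝ := μ * phi ϱhat q with ht
  have ht0 : 0 < t := mul_pos hμ hφ
  rcases le_total r t with hrt | hrt
  · calc r ^ q ≤ t ^ q := pow_le_pow_left₀ hr hrt q
      _ ≤ _ := le_mul_of_one_le_right (by positivity) hexp
  -- With V the normalized weight, q = V(φ(q)) ≤ K V(t) and log x ≤ x^(ρ/2) / (ρ/2). So q log(r/t)
  -- is at most a multiple of (r/t)^(ρ/2) V(t), hence of V(r), because ρ/2 < ρ. No constant depends
  -- on q.
  have hx : 1 ≤ r / t := (one_le_div ht0).2 hrt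
  have ht₁ : μ * phi ϱhat 1 ≤ t := mul_le_mul_of_nonneg_left hφφ hμ.le
  have h1 : (q : ℝ) ≤ K * t ^ ϱhat t := by
    rw [← h.rpow_phi hq0]
    refine (h.rpow_le_rpow hφ ?_).trans (hU t ht₁)
    calc phi ϱhat q = μ⁻¹ * t := by rw [ht, inv_mul_cancel_left₀ hμ.ne']
      _ ≤ _ := mul_le_mul_of_nonneg_right (le_max_right _ _) ht0.le
  have h2 := hL t (r / t) ht₁ hx
  rw [div_mul_cancel₀ _ ht0.ne'] at h2
  have h3 : Real.log (r / t) ≤ (r / t) ^ (ρ / 2) / (ρ / 2) :=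
    Real.log_le_rpow_div (by positivity) (by positivity)
  have h4 : q * Real.log (r / t) ≤ K / (ρ / 2 * κ) * r ^ ϱhat r := by
    calc q * Real.log (r / t) ≤ (K * t ^ ϱhat t) * ((r / t) ^ (ρ / 2) / (ρ / 2)) :=
          mul_le_mul h1 h3 (Real.log_nonneg hx) (by positivity)
      _ = K / (ρ / 2 * κ) * (κ * (r / t) ^ (ρ / 2) * t ^ ϱhat t) := by field_simp
      _ ≤ _ := mul_le_mul_of_nonneg_left h2 (by positivity)
  calc r ^ q = t ^ q * (r / t) ^ q := by rw [← mul_pow, mul_div_cancel₀ _ ht0.ne']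
    _ = t ^ q * Real.exp (q * Real.log (r / t)) := by
      rw [Real.exp_nat_mul, Real.exp_log (by positivity)]
    _ ≤ _ := by gcongr

end IsNormalization

end Weights

/-! ### Estimates in the spaces A_ϱ, the action of operators, and the coefficients of a continuous
map. -/

section Operators

variable {n : ℕ}

lemma growthSubmodule_mono {ϱ : ℝ → ℝ} {σ τ : ℝ} (hστ : σ ≤ τ)
    {f : EuclideanSpace ℂ (Fin n) → ℂ} (hf : f ∈ growthSubmodule n ϱ σ) :
    f ∈ growthSubmodule n ϱ τ ∧ growthNorm ϱ τ f ≤ growthNorm ϱ σ f := by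
  have h (z : EuclideanSpace ℂ (Fin n)) :
      ‖f z‖ ≤ growthNorm ϱ σ f * Real.exp (τ * ‖z‖ ^ ϱ ‖z‖) := by
    refine (norm_le_of_mem hf z).trans ?_
    have := growthNorm_nonneg (ϱ := ϱ) σ f
    gcongr
  exact ⟨mem_growthSubmodule_of_le hf.1 h, growthNorm_le_of_le h⟩

lemma partialDeriv_add {f g : EuclideanSpace ℂ (Fin n) → ℂ} (hf : Differentiable ℂ f)
    (hg : Differentiable ℂ g) (i : Fin n) :
    partialDeriv i (f + g) = partialDeriv i f + partialDeriv i g := by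
  funext z
  simp [partialDeriv, fderiv_add (hf z) (hg z)]

lemma partialDeriv_smul (c : ℂ) {f : EuclideanSpace ℂ (Fin n) → ℂ} (hf : Differentiable ℂ f)
    (i : Fin n) : partialDeriv i (c • f) = c • partialDeriv i f := by
  funext z
  simp [partialDeriv, fderiv_const_smul (hf z)]

lemma iterate_partialDeriv_add {f g : EuclideanSpace ℂ (Fin n) → ℂ} (hf : Differentiable ℂ f)
    (hg : Differentiable ℂ g) (i : Fin n) (k : ℕ) :
    (partialDeriv i)^[k] (f + g) = (partialDeriv i)^[k] f + (partialDeriv i)^[k] g := by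
  induction k with
  | zero => rfl
  | succ k ih =>
    simp only [Function.iterate_succ_apply', ih]
    exact partialDeriv_add (differentiable_iterate_partialDeriv hf i k)
      (differentiable_iterate_partialDeriv hg i k) i

lemma iterate_partialDeriv_smul (c : ℂ) {f : EuclideanSpace ℂ (Fin n) → ℂ}
    (hf : Differentiable ℂ f) (i : Fin n) (k : ℕ) :
    (partialDeriv i)^[k] (c • f) = c • (partialDeriv i)^[k] f := by
  induction k with
  | zero => rfl
  | succ k ih =>
    simp only [Function.iterate_succ_apply', ih]
    exact partialDeriv_smul c (differentiable_iterate_partialDeriv hf i k) i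

lemma iterPartial_add {m : ℕ} (ι : Fin m → Fin n) (α : Fin m → ℕ)
    {f g : EuclideanSpace ℂ (Fin n) → ℂ} (hf : Differentiable ℂ f) (hg : Differentiable ℂ g) :
    iterPartial ι α (f + g) = iterPartial ι α f + iterPartial ι α g := by
  induction m with
  | zero => simp [iterPartial]
  | succ m ih =>
    rw [← Fin.cons_self_tail α, iterPartial_cons, iterPartial_cons, iterPartial_cons, ih]
    exact iterate_partialDeriv_add (differentiable_iterPartial _ _ hf)
      (differentiable_iterPartial _ _ hg) _ _

lemma iterPartial_smul {m : ℕ} (ι : Fin m → Fin n) (α : Fin m → ℕ) (c : ℂ)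
    {f : EuclideanSpace ℂ (Fin n) → ℂ} (hf : Differentiable ℂ f) :
    iterPartial ι α (c • f) = c • iterPartial ι α f := by
  induction m with
  | zero => simp [iterPartial]
  | succ m ih =>
    rw [← Fin.cons_self_tail α, iterPartial_cons, iterPartial_cons, ih]
    exact iterate_partialDeriv_smul c (differentiable_iterPartial _ _ hf) _ _

lemma prod_factorial_pos (α : Fin n → ℕ) : (0 : ℝ) < (∏ i, (α i).factorial : ℕ) := by
  exact_mod_cast Finset.prod_pos fun i _ => Nat.factorial_pos _

variable {ϱ₁ ϱ₂ ϱhat₁ : ℝ → ℝ} {ρ₁ : ℝ}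

/-- The Cauchy estimates for functions in `A_{ϱ,τ}`. -/
lemma exists_norm_multiDeriv_le (h₁ : IsProximateOrder ϱ₁ ρ₁)
    (hhat : IsNormalization ϱhat₁ ϱ₁ ρ₁) (hρ₁ : 0 < ρ₁) {τ : ℝ} (hτ : 0 < τ) :
    ∃ σ : ℝ, 0 < σ ∧ ∃ B : ℝ, 0 < B ∧ ∃ D : ℝ, 0 < D ∧ ∀ f ∈ growthSubmodule n ϱ₁ τ,
      ∀ (α : Fin n → ℕ) (z : EuclideanSpace ℂ (Fin n)),
        ‖multiDeriv α f z‖ * G ϱhat₁ ρ₁ (∑ i, α i) ≤ (∏ i, (α i).factorial : ℕ) *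
          (D * B ^ (∑ i, α i) * growthNorm ϱ₁ τ f * Real.exp (σ * ‖z‖ ^ ϱ₁ ‖z‖)) := by
  obtain ⟨K₁, hK₁, h1⟩ := h₁.exists_rpow_le_of_isBigO hhat.eventuallyEq.symm.isBigO
  obtain ⟨K₂, hK₂, h2⟩ :=
    hhat.isProximateOrder.exists_rpow_le_of_isBigO hhat.eventuallyEq.isBigO
  obtain ⟨K, hK, hadd⟩ := hhat.exists_rpow_le_of_le_add
  refine ⟨τ * K₁ * K * K₂, by positivity,
    (n + 1) * Real.exp (τ * K₁ * K) / (Real.exp 1 * ρ₁) ^ (1 / ρ₁), by positivity,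
    Real.exp (τ * (K₁ * K * K₂ + 2 * K₁ * K + K₁)), Real.exp_pos _, fun f hf α z => ?_⟩
  set q := ∑ i, α i with hq
  have hq0 : (0 : ℝ) < (max q 1 : ℕ) := by
    exact_mod_cast lt_of_lt_of_le one_pos (le_max_right _ _)
  have hφ := hhat.phi_mem hq0
  -- `phi` is controlled only at positive arguments; for q = 0 the replacement is harmless, the
  -- power being 1.
  have hpow : phi ϱhat₁ (max q 1 : ℕ) ^ q = phi ϱhat₁ q ^ q := by
    rcases q.eq_zero_or_pos with h0 | h0
    · simp [h0]
    · rw [max_eq_left h0]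
  set s : ℝ := phi ϱhat₁ (max q 1 : ℕ) with hs
  -- Moving each coordinate by s / (n + 1) keeps w within distance s of z. The normalized weight at
  -- s is `max q 1`, so the growth from z to w costs a factor geometric in q, and so does G_q / (s /
  -- (n + 1))^q.
  have hs0 : 0 < s / (n + 1) := by positivity
  have hN := growthNorm_nonneg (ϱ := ϱ₁) τ f
  have hM (w : EuclideanSpace ℂ (Fin n)) (hw : ‖w - z‖ ≤ n * (s / (n + 1))) :
      ‖f w‖ ≤ growthNorm ϱ₁ τ f *
        (Real.exp (τ * (K₁ * K * K₂ + 2 * K₁ * K + K₁)) * Real.exp (τ * K₁ * K) ^ q *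
          Real.exp (τ * K₁ * K * K₂ * ‖z‖ ^ ϱ₁ ‖z‖)) := by
    refine (norm_le_of_mem hf w).trans (mul_le_mul_of_nonneg_left ?_ hN)
    rw [← Real.exp_nat_mul, ← Real.exp_add, ← Real.exp_add, Real.exp_le_exp]
    have hws : ‖w‖ ≤ ‖z‖ + s := by
      have h3 := norm_add_le (w - z) z
      rw [sub_add_cancel] at h3
      have h4 : n * (s / (n + 1)) ≤ s := by
        rw [mul_div_assoc', div_le_iff₀ (by positivity)]
        linarith
      linarith
    have h5 := hadd ‖w‖ ‖z‖ s (norm_nonneg _) (norm_nonneg _) hφ.le hws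
    rw [hs, hhat.rpow_phi hq0] at h5
    have h6 : ((max q 1 : ℕ) : ℝ) ≤ q + 1 := by
      exact_mod_cast max_le (Nat.le_succ q) (Nat.le_add_left 1 q)
    have h7 := h2 ‖z‖ (norm_nonneg _)
    have h8 : ‖w‖ ^ ϱhat₁ ‖w‖ ≤ K * (K₂ * ‖z‖ ^ ϱ₁ ‖z‖ + K₂ + (q + 1)) + K := by
      refine h5.trans ?_
      gcongr
    have h9 : ‖w‖ ^ ϱ₁ ‖w‖ ≤ K₁ * (K * (K₂ * ‖z‖ ^ ϱ₁ ‖z‖ + K₂ + (q + 1)) + K) + K₁ := by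
      refine (h1 ‖w‖ (norm_nonneg _)).trans ?_
      gcongr
    refine (mul_le_mul_of_nonneg_left h9 hτ.le).trans_eq ?_
    ring
  have hC := norm_iterPartial_le id α hf.1 z hs0 hM
  rw [multiDeriv_eq_iterPartial]
  refine (mul_le_mul_of_nonneg_right hC (hhat.G_pos hρ₁ q).le).trans_eq ?_
  rw [← hq, IsNormalization.G_eq hρ₁, div_pow, div_pow, ← hpow, div_pow, mul_pow]
  field_simp

/-- The norms of the monomials `(w - z)^α`. -/
lemma exists_growthNorm_monomialAt_le
    (hhat : IsNormalization ϱhat₁ ϱ₁ ρ₁) (hρ₁ : 0 < ρ₁) {l : ℝ} (hl : 0 < l) :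
    ∃ τ : ℝ, 0 < τ ∧ ∃ D : ℝ, 0 < D ∧
      ∀ (α : Fin n → ℕ) (z : EuclideanSpace ℂ (Fin n)),
        monomialAt z α ∈ growthSubmodule n ϱ₁ τ ∧
        growthNorm ϱ₁ τ (monomialAt z α) ≤ D * G ϱhat₁ ρ₁ (∑ i, α i) * l ^ (∑ i, α i) *
          Real.exp (τ * ‖z‖ ^ ϱ₁ ‖z‖) := by
  obtain ⟨K, hK, hK'⟩ :=
    hhat.isProximateOrder.exists_rpow_le_of_isBigO hhat.eventuallyEq.isBigO
  -- Halving `l` pays for the factor 2^q in (‖w‖ + ‖z‖)^q ≤ 2^q (‖w‖^q + ‖z‖^q).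
  obtain ⟨τ, hτ, hpow⟩ := hhat.exists_pow_le_G hρ₁ (half_pos hl)
  refine ⟨τ * K, by positivity, 2 * Real.exp (τ * K), by positivity, fun α z => ?_⟩
  set q := ∑ i, α i with hq
  have hG := hhat.G_pos hρ₁ q
  have hr (w : EuclideanSpace ℂ (Fin n)) : ‖w‖ ^ q ≤
      G ϱhat₁ ρ₁ q * (l / 2) ^ q * Real.exp (τ * K) * Real.exp (τ * K * ‖w‖ ^ ϱ₁ ‖w‖) := by
    refine (hpow q ‖w‖ (norm_nonneg _)).trans ?_
    rw [mul_assoc (G ϱhat₁ ρ₁ q * (l / 2) ^ q), ← Real.exp_add]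
    gcongr
    have := mul_le_mul_of_nonneg_left (hK' ‖w‖ (norm_nonneg _)) hτ.le
    linarith
  have key (w : EuclideanSpace ℂ (Fin n)) : ‖monomialAt z α w‖ ≤
      2 * Real.exp (τ * K) * G ϱhat₁ ρ₁ q * l ^ q * Real.exp (τ * K * ‖z‖ ^ ϱ₁ ‖z‖) *
        Real.exp (τ * K * ‖w‖ ^ ϱ₁ ‖w‖) := by
    have h1 : ‖monomialAt z α w‖ ≤ (‖w‖ + ‖z‖) ^ q := by
      rw [monomialAt, norm_prod, hq, ← Finset.prod_pow_eq_pow_sum]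
      refine Finset.prod_le_prod (fun i _ => norm_nonneg _) fun i _ => ?_
      rw [norm_pow]
      refine pow_le_pow_left₀ (norm_nonneg _) ?_ _
      exact (norm_sub_le _ _).trans
        (add_le_add (PiLp.norm_apply_le w i) (PiLp.norm_apply_le z i))
    have h2 : (‖w‖ + ‖z‖) ^ q ≤ 2 ^ q * (‖w‖ ^ q + ‖z‖ ^ q) := by
      refine (add_pow_le (norm_nonneg _) (norm_nonneg _) q).trans ?_
      gcongr
      · exact one_le_two
      · exact Nat.sub_le _ _
    have hone (w : EuclideanSpace ℂ (Fin n)) : 1 ≤ Real.exp (τ * K * ‖w‖ ^ ϱ₁ ‖w‖) :=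
      Real.one_le_exp (by positivity)
    have h3 : Real.exp (τ * K * ‖w‖ ^ ϱ₁ ‖w‖) + Real.exp (τ * K * ‖z‖ ^ ϱ₁ ‖z‖) ≤
        2 * (Real.exp (τ * K * ‖z‖ ^ ϱ₁ ‖z‖) * Real.exp (τ * K * ‖w‖ ^ ϱ₁ ‖w‖)) := by
      have := le_mul_of_one_le_left (Real.exp_pos (τ * K * ‖w‖ ^ ϱ₁ ‖w‖)).le (hone z)
      have := le_mul_of_one_le_right (Real.exp_pos (τ * K * ‖z‖ ^ ϱ₁ ‖z‖)).le (hone w)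
      linarith
    calc ‖monomialAt z α w‖ ≤ 2 ^ q * (‖w‖ ^ q + ‖z‖ ^ q) := h1.trans h2
      _ ≤ 2 ^ q * (G ϱhat₁ ρ₁ q * (l / 2) ^ q * Real.exp (τ * K) *
            Real.exp (τ * K * ‖w‖ ^ ϱ₁ ‖w‖) + G ϱhat₁ ρ₁ q * (l / 2) ^ q * Real.exp (τ * K) *
            Real.exp (τ * K * ‖z‖ ^ ϱ₁ ‖z‖)) := by
          gcongr
          · exact hr w
          · exact hr z
      _ = G ϱhat₁ ρ₁ q * l ^ q * Real.exp (τ * K) *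
            (Real.exp (τ * K * ‖w‖ ^ ϱ₁ ‖w‖) + Real.exp (τ * K * ‖z‖ ^ ϱ₁ ‖z‖)) := by
          rw [div_pow]
          field_simp
      _ ≤ G ϱhat₁ ρ₁ q * l ^ q * Real.exp (τ * K) *
            (2 * (Real.exp (τ * K * ‖z‖ ^ ϱ₁ ‖z‖) * Real.exp (τ * K * ‖w‖ ^ ϱ₁ ‖w‖))) := by
          gcongr
      _ = _ := by ring
  exact ⟨mem_growthSubmodule_of_le (differentiable_monomialAt z α) key, growthNorm_le_of_le key⟩

/-- The terms of `P f` decay geometrically in some step of the inductive system. -/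
lemma exists_norm_term_le (h₁ : IsProximateOrder ϱ₁ ρ₁)
    (hhat : IsNormalization ϱhat₁ ϱ₁ ρ₁) (hρ₁ : 0 < ρ₁)
    (hO : (fun r : ℝ => r ^ ϱ₁ r) =O[atTop] fun r : ℝ => r ^ ϱ₂ r)
    {a : (Fin n → ℕ) → NormalType n ϱ₂} (ha : a ∈ opClass n ϱhat₁ ρ₁ ϱ₂)
    {τ : ℝ} (hτ : 0 < τ) :
    ∃ σ : ℝ, 0 < σ ∧ ∃ C : ℝ, 0 < C ∧ ∀ f ∈ growthSubmodule n ϱ₁ τ,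
      ∀ (α : Fin n → ℕ) (z : EuclideanSpace ℂ (Fin n)),
        ‖a α z * multiDeriv α f z‖ ≤
          (1 / 2) ^ (∑ i, α i) * (C * growthNorm ϱ₁ τ f) * Real.exp (σ * ‖z‖ ^ ϱ₂ ‖z‖) := by
  obtain ⟨K, hK, hK'⟩ := h₁.exists_rpow_le_of_isBigO hO
  obtain ⟨σ₁, hσ₁, B, hB, D, hD, hder⟩ := exists_norm_multiDeriv_le (n := n) h₁ hhat hρ₁ hτ
  -- `B` comes from the type of `f`; this choice of λ cancels it and leaves (1/2)^|α|.
  obtain ⟨σ₂, hσ₂, C, hC, hcoef⟩ := ha (1 / (2 * B)) (by positivity)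
  refine ⟨σ₂ + σ₁ * K, by positivity, C * D * Real.exp (σ₁ * K), by positivity,
    fun f hf α z => ?_⟩
  set q := ∑ i, α i
  have hG := hhat.G_pos hρ₁ q
  have hfac := prod_factorial_pos α
  have hN := growthNorm_nonneg (ϱ := ϱ₁) τ f
  have h1 : ‖a α z‖ ≤ C * (G ϱhat₁ ρ₁ q / (∏ i, (α i).factorial : ℕ)) * (1 / (2 * B)) ^ q *
      Real.exp (σ₂ * ‖z‖ ^ ϱ₂ ‖z‖) :=
    (norm_le_of_mem (hcoef α).1 z).trans
      (mul_le_mul_of_nonneg_right (hcoef α).2 (Real.exp_pos _).le)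
  have h2 := hder f hf α z
  have h3 : Real.exp (σ₁ * ‖z‖ ^ ϱ₁ ‖z‖) ≤
      Real.exp (σ₁ * K) * Real.exp (σ₁ * K * ‖z‖ ^ ϱ₂ ‖z‖) := by
    rw [← Real.exp_add, Real.exp_le_exp]
    have := mul_le_mul_of_nonneg_left (hK' ‖z‖ (norm_nonneg _)) hσ₁.le
    linarith
  calc ‖a α z * multiDeriv α f z‖ = ‖a α z‖ * ‖multiDeriv α f z‖ := norm_mul _ _
    _ ≤ C * (G ϱhat₁ ρ₁ q / (∏ i, (α i).factorial : ℕ)) * (1 / (2 * B)) ^ q *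
          Real.exp (σ₂ * ‖z‖ ^ ϱ₂ ‖z‖) * ‖multiDeriv α f z‖ :=
        mul_le_mul_of_nonneg_right h1 (norm_nonneg _)
    _ = C / (∏ i, (α i).factorial : ℕ) * (1 / (2 * B)) ^ q *
          Real.exp (σ₂ * ‖z‖ ^ ϱ₂ ‖z‖) * (‖multiDeriv α f z‖ * G ϱhat₁ ρ₁ q) := by ring
    _ ≤ C / (∏ i, (α i).factorial : ℕ) * (1 / (2 * B)) ^ q *
          Real.exp (σ₂ * ‖z‖ ^ ϱ₂ ‖z‖) * ((∏ i, (α i).factorial : ℕ) *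
          (D * B ^ q * growthNorm ϱ₁ τ f * (Real.exp (σ₁ * K) *
            Real.exp (σ₁ * K * ‖z‖ ^ ϱ₂ ‖z‖)))) := by
        refine mul_le_mul_of_nonneg_left (h2.trans ?_) (by positivity)
        gcongr
    _ = _ := by
        rw [add_mul, Real.exp_add, one_div_pow, mul_pow, one_div_pow]
        field_simp

/-- The pointwise sum of the series `P f`. -/
def applySeries (a : (Fin n → ℕ) → NormalType n ϱ₂) (f : EuclideanSpace ℂ (Fin n) → ℂ)
    (z : EuclideanSpace ℂ (Fin n)) : ℂ := ∑' α, a α z * multiDeriv α f z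

lemma applySeries_of_norm_term_le {a : (Fin n → ℕ) → NormalType n ϱ₂}
    {f : EuclideanSpace ℂ (Fin n) → ℂ} (hf : Differentiable ℂ f) {σ M : ℝ} (hσ : 0 < σ)
    (hM : 0 ≤ M)
    (hterm : ∀ (α : Fin n → ℕ) (z : EuclideanSpace ℂ (Fin n)), ‖a α z * multiDeriv α f z‖ ≤
      (1 / 2) ^ (∑ i, α i) * M * Real.exp (σ * ‖z‖ ^ ϱ₂ ‖z‖)) {ρ₂ : ℝ}
    (h₂ : IsProximateOrder ϱ₂ ρ₂) :
    (∀ z, HasSum (fun α => a α z * multiDeriv α f z) (applySeries a f z)) ∧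
    applySeries a f ∈ growthSubmodule n ϱ₂ σ ∧
    growthNorm ϱ₂ σ (applySeries a f) ≤ (∑' α : Fin n → ℕ, (1 / 2 : ℝ) ^ (∑ i, α i)) * M := by
  have hgeo : Summable fun α : Fin n → ℕ => (1 / 2 : ℝ) ^ (∑ i, α i) :=
    summable_pow_sum n (by norm_num) (by norm_num)
  have hs (b : ℝ) : Summable fun α : Fin n → ℕ => (1 / 2 : ℝ) ^ (∑ i, α i) * M * b :=
    (hgeo.mul_right M).mul_right b
  have hsum (z : EuclideanSpace ℂ (Fin n)) : Summable fun α => a α z * multiDeriv α f z :=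
    (hs _).of_norm_bounded fun α => hterm α z
  have hle (z : EuclideanSpace ℂ (Fin n)) : ‖applySeries a f z‖ ≤
      (∑' α : Fin n → ℕ, (1 / 2 : ℝ) ^ (∑ i, α i)) * M * Real.exp (σ * ‖z‖ ^ ϱ₂ ‖z‖) := by
    rw [← tsum_mul_right, ← tsum_mul_right]
    exact tsum_of_norm_bounded (hs _).hasSum fun α => hterm α z
  have hdiff : Differentiable ℂ (applySeries a f) := by
    refine differentiable_tsum_of_forall_ball
      (fun α => (a α).differentiable.mul (differentiable_multiDeriv α hf)) fun R => ?_
    obtain ⟨B, -, hB⟩ := h₂.exists_rpow_le R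
    refine ⟨_, hs (Real.exp (σ * B)), fun α z hz => (hterm α z).trans ?_⟩
    have := hB ‖z‖ (norm_nonneg _) (mem_ball_zero_iff.1 hz).le
    gcongr
  exact ⟨fun z => (hsum z).hasSum, mem_growthSubmodule_of_le hdiff hle, growthNorm_le_of_le hle⟩

/-- Operators in the class `𝐃_{ϱ₁→ϱ₂}` act continuously. -/
lemma exists_continuousLinearMap_appliesTo {ρ₂ : ℝ} (h₁ : IsProximateOrder ϱ₁ ρ₁)
    (h₂ : IsProximateOrder ϱ₂ ρ₂) (hhat : IsNormalization ϱhat₁ ϱ₁ ρ₁) (hρ₁ : 0 < ρ₁)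
    (hO : (fun r : ℝ => r ^ ϱ₁ r) =O[atTop] fun r : ℝ => r ^ ϱ₂ r)
    {a : (Fin n → ℕ) → NormalType n ϱ₂} (ha : a ∈ opClass n ϱhat₁ ρ₁ ϱ₂) :
    ∃ T : NormalType n ϱ₁ →L[ℂ] NormalType n ϱ₂, ∀ f, AppliesTo a f (T f) := by
  -- Here σ and C depend on τ alone, so each step is mapped boundedly into a single step; this gives
  -- continuity on the inductive limit.
  have step (τ : ℝ) (hτ : 0 < τ) : ∃ σ : ℝ, 0 < σ ∧ ∃ C : ℝ, 0 < C ∧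
      ∀ f ∈ growthSubmodule n ϱ₁ τ,
        (∀ (α : Fin n → ℕ) (z : EuclideanSpace ℂ (Fin n)), ‖a α z * multiDeriv α f z‖ ≤
          (1 / 2) ^ (∑ i, α i) * (C * growthNorm ϱ₁ τ f) * Real.exp (σ * ‖z‖ ^ ϱ₂ ‖z‖)) ∧
        (∀ z, HasSum (fun α => a α z * multiDeriv α f z) (applySeries a f z)) ∧
        applySeries a f ∈ growthSubmodule n ϱ₂ σ ∧
        growthNorm ϱ₂ σ (applySeries a f) ≤
          (∑' α : Fin n → ℕ, (1 / 2 : ℝ) ^ (∑ i, α i)) * (C * growthNorm ϱ₁ τ f) := by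
    obtain ⟨σ, hσ, C, hC, hterm⟩ := exists_norm_term_le h₁ hhat hρ₁ hO ha hτ
    exact ⟨σ, hσ, C, hC, fun f hf => ⟨hterm f hf, applySeries_of_norm_term_le hf.1 hσ
      (mul_nonneg hC.le (growthNorm_nonneg _ _)) (hterm f hf) h₂⟩⟩
  have hsum (f : NormalType n ϱ₁) (z : EuclideanSpace ℂ (Fin n)) :
      HasSum (fun α => a α z * multiDeriv α f z) (applySeries a f z) := by
    obtain ⟨τ, hτ, hf⟩ := f.2
    obtain ⟨σ, hσ, C, hC, h⟩ := step τ hτ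
    exact (h f.1 hf).2.1 z
  let T : NormalType n ϱ₁ →ₗ[ℂ] NormalType n ϱ₂ :=
    { toFun := fun f => ⟨applySeries a f, by
        obtain ⟨τ, hτ, hf⟩ := f.2
        obtain ⟨σ, hσ, C, hC, h⟩ := step τ hτ
        exact ⟨σ, hσ, (h f.1 hf).2.2.1⟩⟩
      map_add' := fun f g => NormalType.ext fun z => by
        refine (hsum (f + g) z).unique (((hsum f z).add (hsum g z)).congr_fun fun α => ?_)
        change a α z * multiDeriv α (f.1 + g.1) z = _
        rw [multiDeriv_eq_iterPartial, iterPartial_add _ _ f.differentiable g.differentiable]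
        exact mul_add _ _ _
      map_smul' := fun c f => NormalType.ext fun z => by
        refine (hsum (c • f) z).unique (((hsum f z).mul_left c).congr_fun fun α => ?_)
        change a α z * multiDeriv α (c • f.1) z = _
        rw [multiDeriv_eq_iterPartial, iterPartial_smul _ _ _ f.differentiable]
        exact mul_left_comm _ _ _ }
  refine ⟨⟨T, continuous_of_continuous_comp_incl T fun τ hτ => ?_⟩, fun f => ?_⟩
  · obtain ⟨σ, hσ, C, hC, h⟩ := step τ hτ
    let S : GrowthSpace n ϱ₁ τ →ₗ[ℂ] GrowthSpace n ϱ₂ σ :=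
      { toFun := fun f => ⟨applySeries a f.1, (h f.1 f.2).2.2.1⟩
        map_add' := fun f g => Subtype.ext <| by
          exact congrArg (fun h : NormalType n ϱ₂ => h.1)
            (T.map_add (incl n ϱ₁ τ hτ f) (incl n ϱ₁ τ hτ g))
        map_smul' := fun c f => Subtype.ext <| by
          exact congrArg (fun h : NormalType n ϱ₂ => h.1) (T.map_smul c (incl n ϱ₁ τ hτ f)) }
    refine (continuous_incl hσ).comp (S.mkContinuous
      ((∑' α : Fin n → ℕ, (1 / 2 : ℝ) ^ (∑ i, α i)) * C) fun f => ?_).continuous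
    rw [mul_assoc]
    exact (h f.1 f.2).2.2.2
  · obtain ⟨τ, hτ, hf⟩ := f.2
    obtain ⟨σ, hσ, C, hC, h⟩ := step τ hτ
    obtain ⟨hterm, hpt, hmem, -⟩ := h f.1 hf
    let u (α : Fin n → ℕ) : GrowthSpace n ϱ₂ σ :=
      ⟨fun z => a α z * multiDeriv α f z, mem_growthSubmodule_of_le
        ((a α).differentiable.mul (differentiable_multiDeriv α hf.1)) (hterm α)⟩
    refine ⟨fun α => incl n ϱ₂ σ hσ (u α), fun α z => rfl, ?_⟩
    exact hasSum_incl hσ (g := ⟨applySeries a f, hmem⟩) (hasSum_growthSpace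
      ((summable_pow_sum n (by norm_num) (by norm_num)).mul_right (C * growthNorm ϱ₁ τ f.1))
      (fun α => growthNorm_le_of_le (hterm α)) _ hpt)

/-- The expansion of `(w - z)^α` in powers of `w`. -/
lemma monomialAt_eq_sum (z : EuclideanSpace ℂ (Fin n)) (α : Fin n → ℕ)
    (w : EuclideanSpace ℂ (Fin n)) :
    monomialAt z α w = ∑ β ∈ Fintype.piFinset fun i => Finset.range (α i + 1),
      (∏ i, (-z i) ^ (α i - β i) * ((α i).choose (β i) : ℂ)) * monomialAt 0 β w := by
  have h0 (β : Fin n → ℕ) : monomialAt 0 β w = ∏ i, w i ^ β i := by simp [monomialAt]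
  simp only [h0]
  simp only [monomialAt, sub_eq_add_neg, add_pow, Finset.prod_univ_sum,
    ← Finset.prod_mul_distrib]
  exact Finset.sum_congr rfl fun β _ => Finset.prod_congr rfl fun i _ => by ring

lemma monomialAt_mem (hhat : IsNormalization ϱhat₁ ϱ₁ ρ₁) (hρ₁ : 0 < ρ₁)
    (z : EuclideanSpace ℂ (Fin n)) (α : Fin n → ℕ) :
    monomialAt z α ∈ normalTypeSubmodule n ϱ₁ := by
  obtain ⟨τ, hτ, D, hD, h⟩ := exists_growthNorm_monomialAt_le (n := n) hhat hρ₁ one_pos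
  exact ⟨τ, hτ, (h α z).1⟩

/-- The coefficients `a_α(z) = F((· - z)^α)(z) / α!` of a continuous linear map `F`. -/
lemma exists_mem_opClass (h₁ : IsProximateOrder ϱ₁ ρ₁)
    (hhat : IsNormalization ϱhat₁ ϱ₁ ρ₁) (hρ₁ : 0 < ρ₁)
    (hO : (fun r : ℝ => r ^ ϱ₁ r) =O[atTop] fun r : ℝ => r ^ ϱ₂ r)
    (F : NormalType n ϱ₁ →L[ℂ] NormalType n ϱ₂) :
    ∃ a ∈ opClass n ϱhat₁ ρ₁ ϱ₂, ∀ (α : Fin n → ℕ) (z : EuclideanSpace ℂ (Fin n)),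
      a α z = F ⟨monomialAt z α, monomialAt_mem hhat hρ₁ z α⟩ z / (∏ i, (α i).factorial : ℕ) := by
  obtain ⟨K, hK, hK'⟩ := h₁.exists_rpow_le_of_isBigO hO
  let mon (z : EuclideanSpace ℂ (Fin n)) (α : Fin n → ℕ) : NormalType n ϱ₁ :=
    ⟨monomialAt z α, monomialAt_mem hhat hρ₁ z α⟩
  -- The point z occurs both in the monomial and as evaluation point. The binomial expansion
  -- separates the two: a finite sum of polynomials in z times the fixed entire functions F(w^β).
  have hdiff (α : Fin n → ℕ) :
      Differentiable ℂ fun z => F (mon z α) z / (∏ i, (α i).factorial : ℕ) := by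
    have hexp (z : EuclideanSpace ℂ (Fin n)) : F (mon z α) z =
        ∑ β ∈ Fintype.piFinset fun i => Finset.range (α i + 1),
          (∏ i, (-z i) ^ (α i - β i) * ((α i).choose (β i) : ℂ)) * F (mon 0 β) z := by
      have h1 : mon z α = ∑ β ∈ Fintype.piFinset fun i => Finset.range (α i + 1),
          (∏ i, (-z i) ^ (α i - β i) * ((α i).choose (β i) : ℂ)) • mon 0 β := by
        refine NormalType.ext fun w => ?_
        rw [← evalCLM_apply, ← evalCLM_apply, map_sum]
        exact monomialAt_eq_sum z α w
      rw [h1, map_sum, ← evalCLM_apply, map_sum]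
      refine Finset.sum_congr rfl fun β _ => ?_
      rw [map_smul, map_smul]
      rfl
    simp only [hexp]
    have hF (β : Fin n → ℕ) : Differentiable ℂ fun z => F (mon 0 β) z :=
      (F (mon 0 β)).differentiable
    fun_prop
  have hbound (l : ℝ) (hl : 0 < l) : ∃ σ : ℝ, 0 < σ ∧ ∃ C : ℝ, 0 < C ∧
      ∀ (α : Fin n → ℕ) (z : EuclideanSpace ℂ (Fin n)),
        ‖F (mon z α) z / (∏ i, (α i).factorial : ℕ)‖ ≤
          C * (G ϱhat₁ ρ₁ (∑ i, α i) / ((∏ i, (α i).factorial : ℕ) : ℝ)) * l ^ (∑ i, α i) *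
            Real.exp (σ * ‖z‖ ^ ϱ₂ ‖z‖) := by
    obtain ⟨τ, hτ, D, hD, hmon⟩ := exists_growthNorm_monomialAt_le (n := n) hhat hρ₁ hl
    obtain ⟨σ, hσ, C, hC, hF⟩ := exists_norm_apply_incl_le F hτ
    refine ⟨σ + τ * K, by positivity, C * D * Real.exp (τ * K), by positivity, fun α z => ?_⟩
    have hfac := prod_factorial_pos α
    have hG := hhat.G_pos hρ₁ (∑ i, α i)
    have h2 : Real.exp (τ * ‖z‖ ^ ϱ₁ ‖z‖) ≤
        Real.exp (τ * K) * Real.exp (τ * K * ‖z‖ ^ ϱ₂ ‖z‖) := by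
      rw [← Real.exp_add, Real.exp_le_exp]
      have := mul_le_mul_of_nonneg_left (hK' ‖z‖ (norm_nonneg _)) hτ.le
      linarith
    have h3 : ‖F (mon z α) z‖ ≤ C * (D * G ϱhat₁ ρ₁ (∑ i, α i) * l ^ (∑ i, α i) *
        (Real.exp (τ * K) * Real.exp (τ * K * ‖z‖ ^ ϱ₂ ‖z‖))) *
          Real.exp (σ * ‖z‖ ^ ϱ₂ ‖z‖) := by
      refine (hF ⟨monomialAt z α, (hmon α z).1⟩ z).trans ?_
      gcongr
      refine (hmon α z).2.trans ?_
      gcongr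
    rw [norm_div, Complex.norm_natCast, div_le_iff₀ hfac]
    refine h3.trans_eq ?_
    rw [add_mul, Real.exp_add]
    field_simp
  refine ⟨fun α => ⟨fun z => F (mon z α) z / (∏ i, (α i).factorial : ℕ), ?_⟩,
    fun l hl => ?_, fun α z => rfl⟩
  · obtain ⟨σ, hσ, C, hC, h⟩ := hbound 1 one_pos
    exact ⟨σ, hσ, mem_growthSubmodule_of_le (hdiff α) (h α)⟩
  · obtain ⟨σ, hσ, C, hC, h⟩ := hbound l hl
    exact ⟨σ, hσ, C, hC, fun α =>
      ⟨mem_growthSubmodule_of_le (hdiff α) (h α), growthNorm_le_of_le (h α)⟩⟩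

/-- A continuous linear map commutes with the Taylor expansion at any point. -/
lemma hasSum_apply_monomialAt (h₁ : IsProximateOrder ϱ₁ ρ₁)
    (hhat : IsNormalization ϱhat₁ ϱ₁ ρ₁) (hρ₁ : 0 < ρ₁)
    (F : NormalType n ϱ₁ →L[ℂ] NormalType n ϱ₂) (f : NormalType n ϱ₁)
    (z : EuclideanSpace ℂ (Fin n)) :
    HasSum (fun α : Fin n → ℕ => multiDeriv α f z / (∏ i, (α i).factorial : ℕ) *
      F ⟨monomialAt z α, monomialAt_mem hhat hρ₁ z α⟩ z) (F f z) := by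
  obtain ⟨τ₀, hτ₀, hf⟩ := f.2
  obtain ⟨σ, hσ, B, hB, D, hD, hder⟩ := exists_norm_multiDeriv_le (n := n) h₁ hhat hρ₁ hτ₀
  -- In the product of Taylor coefficient and monomial norm, G_q cancels and B^q is reduced to
  -- (1/2)^q. The Taylor series thus converges in one step, to which evaluation after `F` applies
  -- termwise.
  obtain ⟨τ₁, hτ₁, E, hE, hmon⟩ := exists_growthNorm_monomialAt_le (n := n) hhat hρ₁
    (by positivity : 0 < 1 / (2 * B))
  have hτ : 0 < max τ₀ τ₁ := lt_max_of_lt_left hτ₀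
  let mon (α : Fin n → ℕ) : GrowthSpace n ϱ₁ (max τ₀ τ₁) :=
    ⟨monomialAt z α, (growthSubmodule_mono (le_max_right _ _) (hmon α z).1).1⟩
  let g : GrowthSpace n ϱ₁ (max τ₀ τ₁) :=
    ⟨f.1, (growthSubmodule_mono (le_max_left _ _) hf).1⟩
  have hN := growthNorm_nonneg (ϱ := ϱ₁) τ₀ f.1
  have hsum : HasSum (fun α : Fin n → ℕ =>
      (multiDeriv α f z / (∏ i, (α i).factorial : ℕ)) • mon α) g := by
    have hb : Summable fun α : Fin n → ℕ => (1 / 2 : ℝ) ^ (∑ i, α i) *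
        (D * growthNorm ϱ₁ τ₀ f.1 * Real.exp (σ * ‖z‖ ^ ϱ₁ ‖z‖) *
        (E * Real.exp (τ₁ * ‖z‖ ^ ϱ₁ ‖z‖))) :=
      (summable_pow_sum n (x := 1 / 2) (by norm_num) (by norm_num)).mul_right _
    refine hasSum_growthSpace hb (fun α => ?_) g fun w => ?_
    · have hfac := prod_factorial_pos α
      have hG := hhat.G_pos hρ₁ (∑ i, α i)
      have h1 := hder f.1 hf α z
      have h2 : ‖mon α‖ ≤ E * G ϱhat₁ ρ₁ (∑ i, α i) * (1 / (2 * B)) ^ (∑ i, α i) *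
          Real.exp (τ₁ * ‖z‖ ^ ϱ₁ ‖z‖) :=
        (growthSubmodule_mono (le_max_right τ₀ τ₁) (hmon α z).1).2.trans (hmon α z).2
      rw [norm_smul, norm_div, Complex.norm_natCast]
      generalize ‖mon α‖ = m at h2 ⊢
      calc ‖multiDeriv α f z‖ / (∏ i, (α i).factorial : ℕ) * m
          ≤ ‖multiDeriv α f z‖ / (∏ i, (α i).factorial : ℕ) *
              (E * G ϱhat₁ ρ₁ (∑ i, α i) * (1 / (2 * B)) ^ (∑ i, α i) *
                Real.exp (τ₁ * ‖z‖ ^ ϱ₁ ‖z‖)) := by gcongr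
        _ = ‖multiDeriv α f z‖ * G ϱhat₁ ρ₁ (∑ i, α i) / (∏ i, (α i).factorial : ℕ) *
              (E * (1 / (2 * B)) ^ (∑ i, α i) * Real.exp (τ₁ * ‖z‖ ^ ϱ₁ ‖z‖)) := by ring
        _ ≤ (∏ i, (α i).factorial : ℕ) * (D * B ^ (∑ i, α i) * growthNorm ϱ₁ τ₀ f.1 *
              Real.exp (σ * ‖z‖ ^ ϱ₁ ‖z‖)) / (∏ i, (α i).factorial : ℕ) *
              (E * (1 / (2 * B)) ^ (∑ i, α i) * Real.exp (τ₁ * ‖z‖ ^ ϱ₁ ‖z‖)) := by gcongr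
        _ = _ := by
          rw [one_div_pow, mul_pow, one_div_pow]
          field_simp
    · exact hasSum_taylor hf.1 z w
  have h1 := ((evalCLM n ϱ₂ z).comp F).hasSum (hasSum_incl hτ hsum)
  refine h1.congr_fun fun α => ?_
  exact (((evalCLM n ϱ₂ z).comp F).map_smul (multiDeriv α f z / (∏ i, (α i).factorial : ℕ))
    (incl n ϱ₁ _ hτ (mon α))).symm

lemma AppliesTo.hasSum {a : (Fin n → ℕ) → NormalType n ϱ₂} {f : NormalType n ϱ₁}
    {g : NormalType n ϱ₂} (h : AppliesTo a f g) (z : EuclideanSpace ℂ (Fin n)) :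
    HasSum (fun α => a α z * multiDeriv α f z) (g z) := by
  obtain ⟨u, hu, hsum⟩ := h
  exact ((evalCLM n ϱ₂ z).hasSum hsum).congr_fun fun α => (hu α z).symm

/-- The coefficients of an operator are determined by its action on monomials. -/
lemma AppliesTo.coeff_eq {a : (Fin n → ℕ) → NormalType n ϱ₂} {z : EuclideanSpace ℂ (Fin n)}
    {α : Fin n → ℕ} {f : NormalType n ϱ₁} (hf : f.1 = monomialAt z α) {g : NormalType n ϱ₂}
    (h : AppliesTo a f g) : a α z = g z / (∏ i, (α i).factorial : ℕ) := by
  have h1 := h.hasSum z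
  simp only [hf, multiDeriv_monomialAt_self] at h1
  have h2 := h1.unique (hasSum_single α fun β hβ => by simp [hβ])
  have h3 : ((∏ i, (α i).factorial : ℕ) : ℂ) ≠ 0 := by
    exact_mod_cast (Finset.prod_pos fun i _ => Nat.factorial_pos _).ne'
  rw [h2, if_pos rfl, mul_div_cancel_right₀ _ h3]

end Operators

end ProximateOrder

end

/-! ### The theorem. -/

theorem theorem4p5 (n : ℕ) (ϱ₁ ϱ₂ ϱhat₁ : ℝ → ℝ) (ρ₁ ρ₂ : ℝ) (hρ₁ : 0 < ρ₁) (hρ₂ : 0 < ρ₂)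
    (h₁ : ProximateOrder.IsProximateOrder ϱ₁ ρ₁)
    (h₂ : ProximateOrder.IsProximateOrder ϱ₂ ρ₂)
    (hhat : ProximateOrder.IsNormalization ϱhat₁ ϱ₁ ρ₁)
    (hO : (fun r : ℝ => r ^ ϱ₁ r) =O[Filter.atTop] (fun r : ℝ => r ^ ϱ₂ r)) :
    (∀ a ∈ ProximateOrder.opClass n ϱhat₁ ρ₁ ϱ₂,
      ∃ T : ProximateOrder.NormalType n ϱ₁ →L[ℂ] ProximateOrder.NormalType n ϱ₂,
        ∀ f, ProximateOrder.AppliesTo a f (T f)) ∧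
    (∀ F : ProximateOrder.NormalType n ϱ₁ →L[ℂ] ProximateOrder.NormalType n ϱ₂,
      ∃! a : (Fin n → ℕ) → ProximateOrder.NormalType n ϱ₂,
        a ∈ ProximateOrder.opClass n ϱhat₁ ρ₁ ϱ₂ ∧
        ∀ f, ProximateOrder.AppliesTo a f (F f)) := by
  refine ⟨fun a ha => ProximateOrder.exists_continuousLinearMap_appliesTo h₁ h₂ hhat hρ₁ hO ha, fun F => ?_⟩
  obtain ⟨a, ha, haF⟩ := ProximateOrder.exists_mem_opClass h₁ hhat hρ₁ hO F
  refine ⟨a, ⟨ha, fun f => ?_⟩, fun b hb => funext fun α => ProximateOrder.NormalType.ext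
    fun z => ?_⟩
  · obtain ⟨T, hT⟩ := ProximateOrder.exists_continuousLinearMap_appliesTo h₁ h₂ hhat hρ₁ hO ha
    -- At each z both values are sums of the same series: one by the action of `a`, the other by the
    -- Taylor expansion of `f` at z itself.
    have hTF : T f = F f := by
      refine ProximateOrder.NormalType.ext fun z => ((hT f).hasSum z).unique ?_
      refine (ProximateOrder.hasSum_apply_monomialAt h₁ hhat hρ₁ F f z).congr_fun fun α => ?_
      rw [haF]
      ring
    exact hTF ▸ hT f
  -- Applied to (w - z)^α and evaluated at the centre z, the series of `b` has the single nonzero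
  -- term α! times `b α z`.
  · rw [haF]
    exact (hb.2 ⟨ProximateOrder.monomialAt z α,
      ProximateOrder.monomialAt_mem hhat hρ₁ z α⟩).coeff_eq rfl
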